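/- Let $d\in\mathbb N$, let $\mathcal F=\bigoplus_{n\ge 0}L^2_a((\mathbb R^{d})^n)$ be the fermionic Fock space over $L^2(\mathbb R^d)$ ($L^2_a$ denoting the complex-valued antisymmetric square-integrable functions), and for $f\in L^2(\mathbb R^d)$ let $a(f)$ be the annihilation operator, the bounded operator on $\mathcal F$ with $$(a(f)\psi)^{(n)}(x)=\sqrt{n+1}\int_{\mathbb R^d}\overline{f(k)}\,\psi^{(n+1)}(k,x)\,dk ,$$ and $a^\dagger(f)=a(f)^*$. For a closed subspace $\mathfrak K\subseteq L^2(\mathbb R^d)$ let $\mathcal A_{\mathfrak K}$ be the unital $C^*$-algebra of operators on $\mathcal F$ generated by $\{a(g):g\in\mathfrak K\}$, and let $\mathcal A^+_{\mathfrak K}\subseteq\mathcal A_{\mathfrak K}$ be the $C^*$-subalgebra generated by all products $a^\#(g_1)\cdots a^\#(g_k)$ with $k\ge 0$ even, $g_1,\dots,g_k\in\mathfrak K$ and each $a^\#\in\{a,a^\dagger\}$. Put $\mathcal A=\mathcal A_{L^2(\mathbb R^d)}$ and $\mathcal A^+=\mathcal A^+_{L^2(\mathbb R^d)}$. Fix a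 closed subspace $\mathfrak K\subseteq L^2(\mathbb R^d)$ and an orthonormal basis $f_1,f_2,\dots$ (finite or infinite) of $\mathfrak K^\perp$. For each $n$ define the unitary operators $$u_n^{(0)}=1,\quad u_n^{(1)}=a^\dagger(f_n)+a(f_n),\quad u_n^{(2)}=a^\dagger(f_n)-a(f_n),\quad u_n^{(3)}=1-2a^\dagger(f_n)a(f_n),$$ and for bounded $A$ on $\mathcal F$ let $$\mathbb E^N_{\mathfrak K}(A)=\frac1{4^N}\sum_{\alpha\in\{0,1,2,3\}^N}u(\alpha)^*A\,u(\alpha),\qquad u(\alpha)=u_1^{(\alpha_1)}\cdots u_N^{(\alpha_N)} ,$$ where $\mathbb E_{\mathfrak K}^N:=\mathbb E_{\mathfrak K}^{D}$ for $N>D$ if $D=\dim\mathfrak K^\perp<\infty$. Then for every $A\in\mathcal A$ the limit $\mathbb E_{\mathfrak K}(A)=\lim_{N\to\infty}\mathbb E^N_{\mathfrak K}(A)$ exists in operator norm, and $$\mathbb E_{\mathfrak K}(BAC)=B\,\mathbb E_{\mathfrak K}(A)\,C\qquad\text{for all }A\in\mathcal A^+\text{ and }B,C\in\mathcal A^+_{\mathfrak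 K}.$$ -/

import Mathlib

open MeasureTheory Filter Topology

noncomputable section

namespace Fermion

/-- The one-particle space `L²(ℝᵈ)`. -/
abbrev OneParticle (d : ℕ) : Type := Lp ℂ 2 (volume : Measure (EuclideanSpace ℝ (Fin d)))

/-- The `n`-particle space `L²((ℝᵈ)ⁿ) = L²(ℝ^{dn})`. -/
abbrev NParticle (d n : ℕ) : Type :=
  Lp ℂ 2 (volume : Measure (Fin n → EuclideanSpace ℝ (Fin d)))

section Coordinates

variable {d n : ℕ}

theorem measurePreserving_perm (σ : Equiv.Perm (Fin n)) :
    MeasurePreserving (fun x : Fin n → EuclideanSpace ℝ (Fin d) => x ∘ σ) volume volume :=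
  volume_preserving_arrowCongr' σ.symm (MeasurableEquiv.refl _) (MeasurePreserving.id _)

theorem measurePreserving_cons :
    MeasurePreserving (fun p : (Fin n → EuclideanSpace ℝ (Fin d)) × EuclideanSpace ℝ (Fin d) =>
      (Fin.cons p.2 p.1 : Fin (n + 1) → EuclideanSpace ℝ (Fin d)))
      (volume.prod volume) volume := by
  have h := ((volume_preserving_piFinSuccAbove
    (fun _ : Fin (n + 1) => EuclideanSpace ℝ (Fin d)) 0).symm _).comp
    (Measure.measurePreserving_swap (μ := (volume : Measure (Fin n → EuclideanSpace ℝ (Fin d))))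
      (ν := (volume : Measure (EuclideanSpace ℝ (Fin d)))))
  have e : (fun p : (Fin n → EuclideanSpace ℝ (Fin d)) × EuclideanSpace ℝ (Fin d) =>
      (Fin.cons p.2 p.1 : Fin (n + 1) → EuclideanSpace ℝ (Fin d))) =
      (MeasurableEquiv.piFinSuccAbove (fun _ : Fin (n + 1) => EuclideanSpace ℝ (Fin d)) 0).symm ∘
        Prod.swap := by
    funext p
    exact (Fin.insertNth_zero _ _).symm
  rw [e]
  exact h

/-- Permutation of the particles: `(permute σ ψ)(x₀,…,xₙ₋₁) = ψ(x_{σ 0},…,x_{σ (n-1)})`. -/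
def permute (σ : Equiv.Perm (Fin n)) : NParticle d n →ₗᵢ[ℂ] NParticle d n :=
  Lp.compMeasurePreservingₗᵢ ℂ (fun x => x ∘ σ) (measurePreserving_perm σ)

theorem permute_coeFn (σ : Equiv.Perm (Fin n)) (ψ : NParticle d n) :
    permute σ ψ =ᵐ[volume] fun x => ψ (x ∘ σ) :=
  Lp.coeFn_compMeasurePreserving ψ (measurePreserving_perm σ)

theorem permute_mul (σ τ : Equiv.Perm (Fin n)) (ψ : NParticle d n) :
    permute (σ * τ) ψ = permute σ (permute τ ψ) := by
  apply Lp.ext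
  filter_upwards [permute_coeFn (σ * τ) ψ, permute_coeFn σ (permute τ ψ),
    (measurePreserving_perm σ).quasiMeasurePreserving.ae (permute_coeFn τ ψ)] with x h1 h2 h3
  rw [h1, h2, h3]
  rfl

theorem permute_one (ψ : NParticle d n) : permute 1 ψ = ψ := by
  apply Lp.ext
  filter_upwards [permute_coeFn 1 ψ] with x h1
  rw [h1]
  rfl

/-- The function `x ↦ ∫ conj(f(k)) ψ(k, x) dk`. -/
def contractFun (f : EuclideanSpace ℝ (Fin d) → ℂ)
    (ψ : (Fin (n + 1) → EuclideanSpace ℝ (Fin d)) → ℂ) (x : Fin n → EuclideanSpace ℝ (Fin d)) : ℂ :=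
  ∫ k, (starRingEnd ℂ) (f k) * ψ (Fin.cons k x)

theorem memLp_contractFun (f : OneParticle d) (ψ : NParticle d (n + 1)) :
    MemLp (contractFun f ψ) 2 (volume : Measure (Fin n → EuclideanSpace ℝ (Fin d))) := by
  have hψ : AEStronglyMeasurable
      (fun p : (Fin n → EuclideanSpace ℝ (Fin d)) × EuclideanSpace ℝ (Fin d) =>
        ψ (Fin.cons p.2 p.1)) (volume.prod volume) :=
    (Lp.aestronglyMeasurable ψ).comp_measurePreserving measurePreserving_cons
  have hm : AEStronglyMeasurable
      (fun p : (Fin n → EuclideanSpace ℝ (Fin d)) × EuclideanSpace ℝ (Fin d) =>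
        (starRingEnd ℂ) (f p.2) * ψ (Fin.cons p.2 p.1)) (volume.prod volume) :=
    (RCLike.continuous_conj.comp_aestronglyMeasurable
      (Lp.aestronglyMeasurable f).comp_snd).mul hψ
  refine ⟨hm.integral_prod_right', ?_⟩
  rw [eLpNorm_lt_top_iff_lintegral_rpow_enorm_lt_top two_ne_zero ENNReal.ofNat_ne_top]
  have hf : ∫⁻ k, ‖f k‖ₑ ^ (2 : ℝ) < ⊤ := by
    have := (eLpNorm_lt_top_iff_lintegral_rpow_enorm_lt_top two_ne_zero
      ENNReal.ofNat_ne_top).1 (Lp.memLp f).2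
    simpa using this
  have hψ2 : ∫⁻ x : Fin n → EuclideanSpace ℝ (Fin d), ∫⁻ k, ‖ψ (Fin.cons k x)‖ₑ ^ (2 : ℝ) < ⊤ := by
    have h0 := (eLpNorm_lt_top_iff_lintegral_rpow_enorm_lt_top two_ne_zero
      ENNReal.ofNat_ne_top).1 ((Lp.memLp ψ).comp_measurePreserving measurePreserving_cons).2
    rw [lintegral_prod _ (by fun_prop)] at h0
    simpa using h0
  calc ∫⁻ x, ‖contractFun f ψ x‖ₑ ^ ENNReal.toReal 2
      ≤ ∫⁻ x : Fin n → EuclideanSpace ℝ (Fin d), (∫⁻ k, ‖f k‖ₑ ^ (2 : ℝ)) *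
          ∫⁻ k, ‖ψ (Fin.cons k x)‖ₑ ^ (2 : ℝ) := by
        apply lintegral_mono_ae
        filter_upwards [hψ.prodMk_left] with x hx
        have h1 : ‖contractFun f ψ x‖ₑ ≤ ∫⁻ k, ‖f k‖ₑ * ‖ψ (Fin.cons k x)‖ₑ := by
          refine (enorm_integral_le_lintegral_enorm _).trans (le_of_eq ?_)
          simp [enorm_mul]
        have h2 := ENNReal.lintegral_mul_le_Lp_mul_Lq volume Real.HolderConjugate.two_two
          (Lp.aestronglyMeasurable f).enorm hx.enorm
        have h3 := h1.trans h2
        calc ‖contractFun f ψ x‖ₑ ^ ENNReal.toReal 2 ≤ _ := ENNReal.rpow_le_rpow h3 (by simp)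
          _ = _ := by
            rw [ENNReal.mul_rpow_of_nonneg _ _ (by simp), ← ENNReal.rpow_mul, ← ENNReal.rpow_mul]
            simp
    _ = (∫⁻ k, ‖f k‖ₑ ^ (2 : ℝ)) *
          ∫⁻ x : Fin n → EuclideanSpace ℝ (Fin d), ∫⁻ k, ‖ψ (Fin.cons k x)‖ₑ ^ (2 : ℝ) :=
        lintegral_const_mul' _ _ hf.ne
    _ < ⊤ := ENNReal.mul_lt_top hf hψ2

theorem memLp_tensorFun (f : OneParticle d) (φ : NParticle d n) :
    MemLp (fun y : Fin (n + 1) → EuclideanSpace ℝ (Fin d) => f (y 0) * φ (Fin.tail y)) 2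
      volume := by
  have h : MemLp (fun p : (Fin n → EuclideanSpace ℝ (Fin d)) × EuclideanSpace ℝ (Fin d) =>
      f p.2 * φ p.1) 2 (volume.prod volume) := by
    have hm : AEStronglyMeasurable
        (fun p : (Fin n → EuclideanSpace ℝ (Fin d)) × EuclideanSpace ℝ (Fin d) =>
        f p.2 * φ p.1) (volume.prod volume) :=
      (Lp.aestronglyMeasurable f).comp_snd.mul (Lp.aestronglyMeasurable φ).comp_fst
    rw [memLp_two_iff_integrable_sq_norm hm]
    have := ((memLp_two_iff_integrable_sq_norm (Lp.aestronglyMeasurable φ)).1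
      (Lp.memLp φ)).mul_prod ((memLp_two_iff_integrable_sq_norm (Lp.aestronglyMeasurable f)).1
      (Lp.memLp f))
    refine this.congr (Eventually.of_forall fun p => ?_)
    simp only [norm_mul, mul_pow]
    ring
  have h2 := h.comp_measurePreserving
    ((Measure.measurePreserving_swap (μ := (volume : Measure (EuclideanSpace ℝ (Fin d))))
      (ν := (volume : Measure (Fin n → EuclideanSpace ℝ (Fin d))))).comp
      (volume_preserving_piFinSuccAbove (fun _ : Fin (n + 1) => EuclideanSpace ℝ (Fin d)) 0))
  exact h2

/-- The tensor product `f ⊗ φ`, that is `(x₀,…,xₙ) ↦ f(x₀) φ(x₁,…,xₙ)`. -/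
def tensor (f : OneParticle d) (φ : NParticle d n) : NParticle d (n + 1) :=
  (memLp_tensorFun f φ).toLp _

theorem tensor_coeFn (f : OneParticle d) (φ : NParticle d n) :
    tensor f φ =ᵐ[volume] fun y => f (y 0) * φ (Fin.tail y) :=
  MemLp.coeFn_toLp _

theorem tensor_cons (f : OneParticle d) (φ : NParticle d n) :
    ∀ᵐ p ∂((volume : Measure (Fin n → EuclideanSpace ℝ (Fin d))).prod
      (volume : Measure (EuclideanSpace ℝ (Fin d)))),
      tensor f φ (Fin.cons p.2 p.1) = f p.2 * φ p.1 := by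
  filter_upwards [measurePreserving_cons.quasiMeasurePreserving.ae (tensor_coeFn f φ)] with p hp
  rw [hp]
  simp

/-- The class of `contractFun f ψ` in `L²`. -/
def contract₀ (f : OneParticle d) (ψ : NParticle d (n + 1)) : NParticle d n :=
  (memLp_contractFun f ψ).toLp _

theorem contract₀_coeFn (f : OneParticle d) (ψ : NParticle d (n + 1)) :
    contract₀ f ψ =ᵐ[volume] fun x => ∫ k, (starRingEnd ℂ) (f k) * ψ (Fin.cons k x) :=
  MemLp.coeFn_toLp _

theorem inner_contract₀ (f : OneParticle d) (φ : NParticle d n) (ψ : NParticle d (n + 1)) :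
    inner ℂ φ (contract₀ f ψ) = inner ℂ (tensor f φ) ψ := by
  have hi : Integrable (fun y => inner ℂ (tensor f φ y) (ψ y)) volume :=
    L2.integrable_inner _ _
  have hi2 := measurePreserving_cons.integrable_comp_of_integrable hi
  have hi3 : ∫ y, inner ℂ (tensor f φ y) (ψ y) = ∫ p, ((fun y => inner ℂ (tensor f φ y) (ψ y)) ∘
      fun p : (Fin n → EuclideanSpace ℝ (Fin d)) × EuclideanSpace ℝ (Fin d) =>
      (Fin.cons p.2 p.1 : Fin (n + 1) → EuclideanSpace ℝ (Fin d))) p ∂(volume.prod volume) := by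
    have h4 := measurePreserving_cons (d := d) (n := n)
    have h5 : AEStronglyMeasurable (fun y => inner ℂ (tensor f φ y) (ψ y)) (Measure.map
        (fun p : (Fin n → EuclideanSpace ℝ (Fin d)) × EuclideanSpace ℝ (Fin d) =>
        (Fin.cons p.2 p.1 : Fin (n + 1) → EuclideanSpace ℝ (Fin d))) (volume.prod volume)) := by
      rw [h4.map_eq]
      exact hi.aestronglyMeasurable
    have h6 := integral_map h4.measurable.aemeasurable h5
    rw [h4.map_eq] at h6
    exact h6
  rw [L2.inner_def, L2.inner_def, hi3]
  rw [integral_prod _ hi2]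
  apply integral_congr_ae
  filter_upwards [contract₀_coeFn f ψ, Measure.ae_ae_of_ae_prod (tensor_cons f φ)] with x h1 h2
  rw [h1, RCLike.inner_apply, ← integral_mul_const]
  apply integral_congr_ae
  filter_upwards [h2] with k hk
  simp only [Function.comp, hk, RCLike.inner_apply, map_mul]
  ring

theorem contract₀_tensor (f g : OneParticle d) (φ : NParticle d n) :
    contract₀ f (tensor g φ) = inner ℂ f g • φ := by
  apply Lp.ext
  filter_upwards [contract₀_coeFn f (tensor g φ), Lp.coeFn_smul (inner ℂ f g) φ,
    Measure.ae_ae_of_ae_prod (tensor_cons g φ)] with x h1 h2 h3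
  rw [h1, h2, L2.inner_def, Pi.smul_apply, smul_eq_mul, ← integral_mul_const]
  apply integral_congr_ae
  filter_upwards [h3] with k hk
  rw [hk, RCLike.inner_apply]
  ring

theorem norm_tensor (f : OneParticle d) (φ : NParticle d n) : ‖tensor f φ‖ = ‖f‖ * ‖φ‖ := by
  have h : ‖tensor f φ‖ ^ 2 = (‖f‖ * ‖φ‖) ^ 2 := by
    have h1 := inner_contract₀ f φ (tensor f φ)
    rw [contract₀_tensor, inner_smul_right, inner_self_eq_norm_sq_to_K,
      inner_self_eq_norm_sq_to_K, inner_self_eq_norm_sq_to_K] at h1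
    rw [mul_pow]
    exact_mod_cast h1.symm
  exact (sq_eq_sq₀ (norm_nonneg _) (by positivity)).1 h

/-- The bounded operator `L²(ℝ^{d(n+1)}) → L²(ℝ^{dn})`,
`(contract f ψ)(x) = ∫ conj(f(k)) ψ(k, x) dk`. -/
def contract (f : OneParticle d) : NParticle d (n + 1) →L[ℂ] NParticle d n :=
  LinearMap.mkContinuous
    { toFun := contract₀ f
      map_add' := fun ψ ψ' => ext_inner_left ℂ fun φ => by
        simp only [inner_add_right, inner_contract₀]
      map_smul' := fun c ψ => ext_inner_left ℂ fun φ => by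
        simp only [inner_smul_right, inner_contract₀, RingHom.id_apply] }
    ‖f‖ fun ψ => by
      have h1 : ‖contract₀ f ψ‖ * ‖contract₀ f ψ‖ ≤ ‖f‖ * ‖ψ‖ * ‖contract₀ f ψ‖ := by
        have h2 := norm_inner_le_norm (𝕜 := ℂ) (tensor f (contract₀ f ψ)) ψ
        rw [← inner_contract₀, inner_self_eq_norm_sq_to_K, norm_tensor] at h2
        have h3 : ‖contract₀ f ψ‖ ^ 2 ≤ ‖f‖ * ‖contract₀ f ψ‖ * ‖ψ‖ := by simpa using h2
        nlinarith [h3]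
      rcases (norm_nonneg (contract₀ f ψ)).eq_or_lt with h | h
      · change ‖contract₀ f ψ‖ ≤ _
        rw [← h]; positivity
      · exact le_of_mul_le_mul_right h1 h

theorem contract_coeFn (f : OneParticle d) (ψ : NParticle d (n + 1)) :
    contract f ψ =ᵐ[volume] fun x => ∫ k, (starRingEnd ℂ) (f k) * ψ (Fin.cons k x) :=
  contract₀_coeFn f ψ

theorem inner_contract (f : OneParticle d) (φ : NParticle d n) (ψ : NParticle d (n + 1)) :
    inner ℂ φ (contract f ψ) = inner ℂ (tensor f φ) ψ :=
  inner_contract₀ f φ ψ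

/-- The antisymmetric functions in `L²(ℝ^{dn})`: `ψ(x_{σ 0},…,x_{σ (n-1)}) = sgn(σ) ψ(x₀,…,xₙ₋₁)`
for almost every `x` and every permutation `σ`. -/
def antisymmetric (d n : ℕ) : Submodule ℂ (NParticle d n) where
  carrier := {ψ | ∀ σ : Equiv.Perm (Fin n), permute σ ψ = ((Equiv.Perm.sign σ : ℤ) : ℂ) • ψ}
  add_mem' := fun h h' σ => by rw [map_add, h σ, h' σ, smul_add]
  zero_mem' := fun σ => by rw [map_zero, smul_zero]
  smul_mem' := fun c ψ h σ => by rw [map_smul, h σ, smul_comm]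

theorem isClosed_antisymmetric (d n : ℕ) : IsClosed (antisymmetric d n : Set (NParticle d n)) := by
  have : (antisymmetric d n : Set (NParticle d n)) = ⋂ σ : Equiv.Perm (Fin n),
      {ψ | permute σ ψ = ((Equiv.Perm.sign σ : ℤ) : ℂ) • ψ} := by
    ext ψ
    simp [antisymmetric]
  rw [this]
  exact isClosed_iInter fun σ =>
    isClosed_eq (permute σ).continuous (continuous_const_smul _)

instance (d n : ℕ) : CompleteSpace (antisymmetric d n) :=
  (isClosed_antisymmetric d n).completeSpace_coe

theorem permute_tensor (f : OneParticle d) (σ : Equiv.Perm (Fin n)) (φ : NParticle d n) :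
    permute (Equiv.Perm.decomposeFin.symm (0, σ)) (tensor f φ) = tensor f (permute σ φ) := by
  have ht : Measure.QuasiMeasurePreserving
      (fun y : Fin (n + 1) → EuclideanSpace ℝ (Fin d) => Fin.tail y) volume volume :=
    Measure.quasiMeasurePreserving_snd.comp (volume_preserving_piFinSuccAbove
      (fun _ : Fin (n + 1) => EuclideanSpace ℝ (Fin d)) 0).quasiMeasurePreserving
  apply Lp.ext
  filter_upwards [permute_coeFn (Equiv.Perm.decomposeFin.symm (0, σ)) (tensor f φ),
    (measurePreserving_perm (Equiv.Perm.decomposeFin.symm (0, σ))).quasiMeasurePreserving.ae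
      (tensor_coeFn f φ), tensor_coeFn f (permute σ φ), ht.ae (permute_coeFn σ φ)] with y h1 h2 h3 h4
  rw [h1, h2, h3, h4]
  have e0 : (y ∘ Equiv.Perm.decomposeFin.symm (0, σ)) 0 = y 0 := by simp
  have e1 : Fin.tail (y ∘ Equiv.Perm.decomposeFin.symm (0, σ)) = Fin.tail y ∘ σ := by
    funext i
    simp [Fin.tail, Equiv.Perm.decomposeFin_symm_apply_succ]
  rw [e0, e1]

theorem contract_permute (f : OneParticle d) (σ : Equiv.Perm (Fin n)) (ψ : NParticle d (n + 1)) :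
    contract f (permute (Equiv.Perm.decomposeFin.symm (0, σ)) ψ) = permute σ (contract f ψ) := by
  refine ext_inner_left ℂ fun φ => ?_
  obtain ⟨φ', rfl⟩ : ∃ φ', permute σ φ' = φ :=
    ⟨permute σ⁻¹ φ, by rw [← permute_mul, mul_inv_cancel, permute_one]⟩
  rw [inner_contract, ← permute_tensor, LinearIsometry.inner_map_map, LinearIsometry.inner_map_map,
    inner_contract]

theorem contract_mem (f : OneParticle d) {ψ : NParticle d (n + 1)}
    (hψ : ψ ∈ antisymmetric d (n + 1)) : contract f ψ ∈ antisymmetric d n := fun σ => by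
  rw [← contract_permute, hψ, map_smul, Equiv.Perm.decomposeFin.symm_sign, if_pos rfl, one_mul]

theorem contract_swap_tensor (f g : OneParticle d) (χ : NParticle d (n + 1)) :
    contract f (permute (Equiv.swap 0 1) (tensor g χ)) = tensor g (contract f χ) := by
  have ht : Measure.QuasiMeasurePreserving
      (fun y : Fin (n + 1) → EuclideanSpace ℝ (Fin d) => Fin.tail y) volume volume :=
    Measure.quasiMeasurePreserving_snd.comp (volume_preserving_piFinSuccAbove
      (fun _ : Fin (n + 1) => EuclideanSpace ℝ (Fin d)) 0).quasiMeasurePreserving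
  have hq := measurePreserving_cons (d := d) (n := n + 1)
  apply Lp.ext
  filter_upwards [contract_coeFn f (permute (Equiv.swap 0 1) (tensor g χ)),
    tensor_coeFn g (contract f χ), ht.ae (contract_coeFn f χ),
    Measure.ae_ae_of_ae_prod
      (hq.quasiMeasurePreserving.ae (permute_coeFn (Equiv.swap 0 1) (tensor g χ))),
    Measure.ae_ae_of_ae_prod (hq.quasiMeasurePreserving.ae
      ((measurePreserving_perm (Equiv.swap 0 1)).quasiMeasurePreserving.ae (tensor_coeFn g χ)))]
    with x h1 h2 h3 h4 h5
  rw [h1, h2, h3, ← integral_const_mul]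
  apply integral_congr_ae
  filter_upwards [h4, h5] with k h6 h7
  rw [h6, h7]
  have e : Fin.tail ((Fin.cons k x : Fin (n + 2) → EuclideanSpace ℝ (Fin d)) ∘ Equiv.swap 0 1) =
      Fin.cons k (Fin.tail x) := by
    funext i
    refine Fin.cases ?_ (fun j => ?_) i
    · simp [Fin.tail]
    · have h8 : Equiv.swap (0 : Fin (n + 2)) 1 j.succ.succ = j.succ.succ :=
        Equiv.swap_apply_of_ne_of_ne (Fin.succ_ne_zero _)
          (fun h => Fin.succ_ne_zero j (Fin.succ_injective _ h))
      simp [Fin.tail, h8]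
  rw [e]
  have e2 : ((Fin.cons k x : Fin (n + 2) → EuclideanSpace ℝ (Fin d)) ∘ Equiv.swap 0 1) 0 = x 0 := by
    simp only [Function.comp, Equiv.swap_apply_left]
    rfl
  rw [e2]
  ring

theorem swap_tensor_tensor (f : OneParticle d) (φ : NParticle d n) :
    permute (Equiv.swap 0 1) (tensor f (tensor f φ)) = tensor f (tensor f φ) := by
  have ht : Measure.QuasiMeasurePreserving
      (fun y : Fin (n + 2) → EuclideanSpace ℝ (Fin d) => Fin.tail y) volume volume :=
    Measure.quasiMeasurePreserving_snd.comp (volume_preserving_piFinSuccAbove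
      (fun _ : Fin (n + 2) => EuclideanSpace ℝ (Fin d)) 0).quasiMeasurePreserving
  have hs := (measurePreserving_perm (d := d)
    (Equiv.swap (0 : Fin (n + 2)) 1)).quasiMeasurePreserving
  have h0 := tensor_coeFn f (tensor f φ)
  have h1 := ht.ae (tensor_coeFn f φ)
  apply Lp.ext
  filter_upwards [permute_coeFn (Equiv.swap 0 1) (tensor f (tensor f φ)), h0, h1, hs.ae h0,
    hs.ae h1] with y g1 g2 g3 g4 g5
  rw [g1, g4, g5, g2, g3]
  have e : Fin.tail (Fin.tail (y ∘ Equiv.swap 0 1)) = Fin.tail (Fin.tail y) := by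
    funext j
    have h8 : Equiv.swap (0 : Fin (n + 2)) 1 j.succ.succ = j.succ.succ :=
      Equiv.swap_apply_of_ne_of_ne (Fin.succ_ne_zero _)
        (fun h => Fin.succ_ne_zero j (Fin.succ_injective _ h))
    simp [Fin.tail, h8]
  have e0 : (y ∘ Equiv.swap 0 1) 0 = y 1 := by simp
  have e1 : Fin.tail (y ∘ Equiv.swap 0 1) 0 = y 0 := by simp [Fin.tail]
  have e2 : Fin.tail y 0 = y 1 := rfl
  rw [e, e0, e1, e2]
  ring

theorem contract_contract (f : OneParticle d) {ψ : NParticle d (n + 2)}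
    (hψ : ψ ∈ antisymmetric d (n + 2)) : contract f (contract f ψ) = 0 := by
  refine ext_inner_left ℂ fun φ => ?_
  rw [inner_contract, inner_contract, inner_zero_right]
  have h := LinearIsometry.inner_map_map (permute (Equiv.swap 0 1)) (tensor f (tensor f φ)) ψ
  rw [swap_tensor_tensor, hψ, inner_smul_right, Equiv.Perm.sign_swap (by simp)] at h
  have h2 : -inner ℂ (tensor f (tensor f φ)) ψ = inner ℂ (tensor f (tensor f φ)) ψ := by
    simpa using h
  exact self_eq_neg.1 h2.symm

theorem inner_tensor_permute (f : OneParticle d) {χ : NParticle d n} (hχ : χ ∈ antisymmetric d n)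
    (hc : ∀ (m : ℕ) (e : n = m + 1), contract f (e ▸ χ) = 0) (π : Equiv.Perm (Fin (n + 1)))
    (hπ : π 0 ≠ 0) : inner ℂ (tensor f χ) (permute π (tensor f χ)) = 0 := by
  obtain ⟨⟨p, σ⟩, rfl⟩ := Equiv.Perm.decomposeFin.symm.surjective π
  rw [Equiv.Perm.decomposeFin_symm_apply_zero] at hπ
  rcases n with _ | m
  · exact absurd (Subsingleton.elim p 0) hπ
  have hc' : contract f χ = 0 := hc m rfl
  -- every permutation moving `0` is `ρ * swap 0 1 * τ` with `ρ`, `τ` fixing `0`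
  obtain ⟨q, rfl⟩ := Fin.exists_succ_eq.2 hπ
  set ρ : Equiv.Perm (Fin (m + 2)) := Equiv.Perm.decomposeFin.symm (0, Equiv.swap 0 q) with hρ
  obtain ⟨⟨r, τ⟩, hτ⟩ := Equiv.Perm.decomposeFin.symm.surjective
    (Equiv.swap 0 1 * ρ⁻¹ * Equiv.Perm.decomposeFin.symm (q.succ, σ))
  have hr : r = 0 := by
    have h0 := congrArg (fun e : Equiv.Perm (Fin (m + 2)) => e 0) hτ
    simp only [Equiv.Perm.decomposeFin_symm_apply_zero, Equiv.Perm.mul_apply] at h0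
    have h1 : ρ 1 = q.succ := by
      rw [hρ, Equiv.Perm.decomposeFin_symm_apply_one]
      simp
    have h2 : ρ⁻¹ (ρ 1) = 1 := ρ.symm_apply_apply 1
    rw [h0, ← h1, h2, Equiv.swap_apply_right]
  subst hr
  have hdec : Equiv.Perm.decomposeFin.symm (q.succ, σ) =
      ρ * (Equiv.swap 0 1 * Equiv.Perm.decomposeFin.symm (0, τ)) := by
    rw [hτ, ← mul_assoc, ← mul_assoc, ← mul_assoc]
    simp [mul_assoc]
  rw [hdec, permute_mul, permute_mul, permute_tensor, hχ τ, ← inner_contract, hρ, contract_permute]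
  have ht : tensor f (((Equiv.Perm.sign τ : ℤ) : ℂ) • χ) =
      ((Equiv.Perm.sign τ : ℤ) : ℂ) • tensor f χ := by
    refine ext_inner_right ℂ fun ψ => ?_
    rw [← inner_contract, inner_smul_left, inner_smul_left, inner_contract]
  rw [ht, map_smul, map_smul, contract_swap_tensor, hc']
  have hz : tensor f (0 : NParticle d m) = 0 := norm_eq_zero.1 (by rw [norm_tensor]; simp)
  rw [hz]
  simp

/-- The bound behind the boundedness of the annihilation operators: on antisymmetric functions
contraction with `f` gains a factor `(n + 1)^{-1/2}`. -/
theorem norm_contract_le (f : OneParticle d) {ψ : NParticle d (n + 1)}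
    (hψ : ψ ∈ antisymmetric d (n + 1)) : (n + 1) * ‖contract f ψ‖ ^ 2 ≤ ‖f‖ ^ 2 * ‖ψ‖ ^ 2 := by
  set χ := contract f ψ with hχ
  set c : Fin (n + 1) → ℂ := fun j => ((Equiv.Perm.sign (Equiv.swap 0 j) : ℤ) : ℂ) with hcdef
  have hc2 : ∀ j, (starRingEnd ℂ) (c j) * c j = 1 := fun j => by
    rcases Int.units_eq_one_or (Equiv.Perm.sign (Equiv.swap 0 j)) with h | h <;>
      simp only [hcdef, h] <;> simp
  set v : Fin (n + 1) → NParticle d (n + 1) := fun j =>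
    c j • permute (Equiv.swap 0 j) (tensor f χ) with hv
  have hvψ : ∀ j, inner ℂ (v j) ψ = ((‖χ‖ ^ 2 : ℝ) : ℂ) := fun j => by
    have h1 : ψ = c j • permute (Equiv.swap 0 j) ψ := by
      rw [hψ, smul_smul]
      change ψ = (c j * c j) • ψ
      have : c j * c j = 1 := by
        have := hc2 j
        simpa [hcdef] using this
      rw [this, one_smul]
    conv_lhs => rw [h1]
    rw [hv]
    simp only
    rw [inner_smul_left, inner_smul_right, LinearIsometry.inner_map_map, ← mul_assoc, hc2, one_mul,
      ← inner_contract, inner_self_eq_norm_sq_to_K]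
    simp
  have hvv : ∀ i j, inner ℂ (v i) (v j) = if i = j then (((‖f‖ * ‖χ‖) ^ 2 : ℝ) : ℂ) else 0 := by
    intro i j
    split_ifs with hij
    · subst hij
      rw [hv]
      simp only
      rw [inner_smul_left, inner_smul_right, LinearIsometry.inner_map_map, ← mul_assoc, hc2,
        one_mul, inner_self_eq_norm_sq_to_K, norm_tensor]
      simp
    · rw [hv]
      simp only
      have h1 : permute (Equiv.swap 0 j) (tensor f χ) = permute (Equiv.swap 0 i)
          (permute (Equiv.swap 0 i * Equiv.swap 0 j) (tensor f χ)) := by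
        rw [← permute_mul, ← mul_assoc, Equiv.swap_mul_self, one_mul]
      rw [inner_smul_left, inner_smul_right, h1, LinearIsometry.inner_map_map,
        inner_tensor_permute f (contract_mem f hψ)]
      · simp
      · rintro m rfl
        exact contract_contract f hψ
      · rw [Equiv.Perm.mul_apply, Equiv.swap_apply_left]
        by_cases hj : j = 0
        · rw [hj, Equiv.swap_apply_left]
          exact fun h => hij (h.trans hj.symm)
        · rw [Equiv.swap_apply_of_ne_of_ne hj (fun h => hij h.symm)]
          exact hj
  have h1 : inner ℂ (∑ j, v j) ψ = (((n + 1) * ‖χ‖ ^ 2 : ℝ) : ℂ) := by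
    rw [sum_inner, Finset.sum_congr rfl fun j _ => hvψ j]
    simp
  have h2 : ‖∑ j, v j‖ ^ 2 = (n + 1) * (‖f‖ * ‖χ‖) ^ 2 := by
    have h3 : inner ℂ (∑ j, v j) (∑ j, v j) = (((n + 1) * (‖f‖ * ‖χ‖) ^ 2 : ℝ) : ℂ) := by
      simp only [sum_inner, inner_sum, hvv]
      simp
    rw [inner_self_eq_norm_sq_to_K] at h3
    exact Complex.ofReal_injective (by rw [← h3]; simp)
  have h4 : (n + 1) * ‖χ‖ ^ 2 ≤ ‖∑ j, v j‖ * ‖ψ‖ := by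
    have h5 := norm_inner_le_norm (𝕜 := ℂ) (∑ j, v j) ψ
    rw [h1, Complex.norm_real, Real.norm_of_nonneg (by positivity)] at h5
    exact h5
  rcases (norm_nonneg χ).eq_or_lt with h | h
  · rw [← h]
    have : 0 ≤ ‖f‖ ^ 2 * ‖ψ‖ ^ 2 := by positivity
    simpa using this
  · have h6 : ((n + 1) * ‖χ‖ ^ 2) ^ 2 ≤ (n + 1) * (‖f‖ * ‖χ‖) ^ 2 * ‖ψ‖ ^ 2 := by
      rw [← h2, ← mul_pow]
      exact pow_le_pow_left₀ (by positivity) h4 2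
    have h7 : 0 < ((n : ℝ) + 1) * ‖χ‖ ^ 2 := by positivity
    refine le_of_mul_le_mul_left ?_ h7
    calc _ = ((n + 1) * ‖χ‖ ^ 2) ^ 2 := by ring
      _ ≤ _ := h6
      _ = _ := by ring

end Coordinates

/-- The fermionic Fock space `⨁ₙ L²_a(ℝ^{dn})`, a Hilbert space direct sum. -/
def Fock (d : ℕ) : Type := lp (fun n => antisymmetric d n) 2

instance (d : ℕ) : NormedAddCommGroup (Fock d) :=
  inferInstanceAs (NormedAddCommGroup (lp (fun n => antisymmetric d n) 2))

instance (d : ℕ) : InnerProductSpace ℂ (Fock d) :=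
  inferInstanceAs (InnerProductSpace ℂ (lp (fun n => antisymmetric d n) 2))

instance (d : ℕ) : CompleteSpace (Fock d) :=
  inferInstanceAs (CompleteSpace (lp (fun n => antisymmetric d n) 2))

/-- The `n`-particle component `ψ⁽ⁿ⁾` of a Fock space vector. -/
def Fock.sector {d : ℕ} (ψ : Fock d) (n : ℕ) : antisymmetric d n :=
  (show lp (fun n => antisymmetric d n) 2 from ψ) n

section Operators

variable {d : ℕ}

/-- The action of `a(f)` from the `(n+1)`-particle sector to the `n`-particle sector. -/
def annihilationSector (f : OneParticle d) (n : ℕ) :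
    antisymmetric d (n + 1) →ₗ[ℂ] antisymmetric d n :=
  (Real.sqrt (n + 1) : ℂ) •
    LinearMap.restrict (contract f).toLinearMap
      (fun ψ (hψ : ψ ∈ antisymmetric d (n + 1)) => contract_mem f hψ)

theorem annihilationSector_coeFn (f : OneParticle d) (n : ℕ) (ψ : antisymmetric d (n + 1)) :
    (annihilationSector f n ψ : NParticle d n) =ᵐ[volume] fun x =>
      Real.sqrt (n + 1) * ∫ k, (starRingEnd ℂ) (f k) * (ψ : NParticle d (n + 1)) (Fin.cons k x) := by
  have h := Lp.coeFn_smul (Real.sqrt (n + 1) : ℂ) (contract f (ψ : NParticle d (n + 1)))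
  filter_upwards [h, contract_coeFn f (ψ : NParticle d (n + 1))] with x h1 h2
  change ((Real.sqrt (n + 1) : ℂ) • contract f (ψ : NParticle d (n + 1)) : NParticle d n) x = _
  rw [h1, Pi.smul_apply, smul_eq_mul, h2]

theorem norm_annihilationSector_le (f : OneParticle d) (n : ℕ) (ψ : antisymmetric d (n + 1)) :
    ‖annihilationSector f n ψ‖ ^ 2 ≤ ‖f‖ ^ 2 * ‖ψ‖ ^ 2 := by
  have h := norm_contract_le f ψ.2
  have h1 : ‖annihilationSector f n ψ‖ =
      ‖(Real.sqrt (n + 1) : ℂ) • contract f (ψ : NParticle d (n + 1))‖ := rfl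
  rw [h1, norm_smul, mul_pow, Complex.norm_real, Real.norm_of_nonneg (Real.sqrt_nonneg _),
    Real.sq_sqrt (by positivity)]
  exact h

theorem summable_fock (ψ : Fock d) : Summable fun n => ‖ψ.sector n‖ ^ 2 := by
  have h := (lp.memℓp (show lp (fun n => antisymmetric d n) 2 from ψ)).summable (by simp)
  simp only [ENNReal.toReal_ofNat, Real.rpow_ofNat] at h
  exact h

theorem norm_sq_fock (ψ : Fock d) : ‖ψ‖ ^ 2 = ∑' n, ‖ψ.sector n‖ ^ 2 := by
  have h := lp.norm_rpow_eq_tsum (p := 2) (by simp)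
    (show lp (fun n => antisymmetric d n) 2 from ψ)
  simp only [ENNReal.toReal_ofNat, Real.rpow_ofNat] at h
  exact h

theorem memℓp_annihilationSector (f : OneParticle d) (ψ : Fock d) :
    Memℓp (fun n => annihilationSector f n (ψ.sector (n + 1))) 2 := by
  refine memℓp_gen ?_
  have h := ((summable_nat_add_iff 1).2 (summable_fock ψ)).mul_left (‖f‖ ^ 2)
  simpa using Summable.of_nonneg_of_le (fun n => by positivity)
    (fun n => norm_annihilationSector_le f n (ψ.sector (n + 1))) h

/-- The annihilation operator `a(f)` on Fock space:
`(a(f)ψ)⁽ⁿ⁾(x) = √(n+1) ∫ conj(f(k)) ψ⁽ⁿ⁺¹⁾(k, x) dk`. -/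
def annihilation (f : OneParticle d) : Fock d →L[ℂ] Fock d :=
  LinearMap.mkContinuous
    { toFun := fun ψ =>
        ⟨fun n => annihilationSector f n (ψ.sector (n + 1)), memℓp_annihilationSector f ψ⟩
      map_add' := fun ψ ψ' => Subtype.ext <| funext fun n =>
        (annihilationSector f n).map_add (ψ.sector (n + 1)) (ψ'.sector (n + 1))
      map_smul' := fun c ψ => Subtype.ext <| funext fun n =>
        (annihilationSector f n).map_smul c (ψ.sector (n + 1)) }
    ‖f‖ fun ψ => by
      refine abs_le_of_sq_le_sq' ?_ (by positivity) |>.2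
      rw [norm_sq_fock, mul_pow, norm_sq_fock ψ, ← tsum_mul_left]
      have h0 := (summable_fock ψ).mul_left (‖f‖ ^ 2)
      have h := (summable_nat_add_iff 1).2 h0
      refine (Summable.tsum_le_tsum (fun n => norm_annihilationSector_le f n (ψ.sector (n + 1)))
        (Summable.of_nonneg_of_le (fun n => by positivity)
          (fun n => norm_annihilationSector_le f n (ψ.sector (n + 1))) h) h).trans ?_
      rw [h0.tsum_eq_zero_add]
      have : 0 ≤ ‖f‖ ^ 2 * ‖ψ.sector 0‖ ^ 2 := by positivity
      linarith

/-- The formula defining `a(f)`, for every `n` and almost every `x ∈ (ℝᵈ)ⁿ`. -/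
theorem annihilation_coeFn (f : OneParticle d) (ψ : Fock d) (n : ℕ) :
    ((annihilation f ψ).sector n : NParticle d n) =ᵐ[volume] fun x =>
      Real.sqrt (n + 1) *
        ∫ k, (starRingEnd ℂ) (f k) * (ψ.sector (n + 1) : NParticle d (n + 1)) (Fin.cons k x) :=
  annihilationSector_coeFn f n (ψ.sector (n + 1))

/-- The creation operator `a†(f) = a(f)*`. -/
def creation (f : OneParticle d) : Fock d →L[ℂ] Fock d := star (annihilation f)

/-- The C*-algebra `𝒜_𝔎 = C*({a(g) : g ∈ 𝔎})`, a norm-closed unital *-subalgebra of the bounded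
operators on Fock space. The CAR algebra `𝒜` is the case `𝔎 = L²(ℝᵈ)`, i.e. `carAlgebra ⊤`. -/
def carAlgebra (K : Submodule ℂ (OneParticle d)) : StarSubalgebra ℂ (Fock d →L[ℂ] Fock d) :=
  (StarAlgebra.adjoin ℂ {T | ∃ g ∈ K, T = annihilation g}).topologicalClosure

/-- Monomials `a^#(g₁) ⋯ a^#(g_k)` with `k` even and `g₁, …, g_k ∈ 𝔎`, where each `a^#` is `a` or
`a†`. -/
def evenMonomials (K : Submodule ℂ (OneParticle d)) : Set (Fock d →L[ℂ] Fock d) :=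
  {M | ∃ l : List (Fock d →L[ℂ] Fock d), Even l.length ∧
    (∀ T ∈ l, ∃ g ∈ K, T = annihilation g ∨ T = creation g) ∧ M = l.prod}

/-- The C*-algebra `𝒜_𝔎⁺` generated by the even monomials; `𝒜⁺` is `evenAlgebra ⊤`. -/
def evenAlgebra (K : Submodule ℂ (OneParticle d)) : StarSubalgebra ℂ (Fock d →L[ℂ] Fock d) :=
  (StarAlgebra.adjoin ℂ (evenMonomials K)).topologicalClosure

/-- The operators `u⁽⁰⁾ = 1`, `u⁽¹⁾ = a†(g) + a(g)`, `u⁽²⁾ = a†(g) - a(g)`,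
`u⁽³⁾ = 1 - 2 a†(g) a(g)` of one mode `g`. -/
def modeUnitary (g : OneParticle d) : Fin 4 → (Fock d →L[ℂ] Fock d) :=
  ![1, creation g + annihilation g, creation g - annihilation g,
    1 - (2 : ℂ) • (creation g * annihilation g)]

/-- The ordered product `u(α) = u₁^(α₁) ⋯ u_M^(α_M)`. -/
def wordUnitary {M : ℕ} (g : Fin M → OneParticle d) (α : Fin M → Fin 4) :
    Fock d →L[ℂ] Fock d :=
  (List.ofFn fun i => modeUnitary (g i) (α i)).prod

/-- The Kraus average `4^{-M} ∑_α u(α)* A u(α)` over `α ∈ {0,1,2,3}^M`. -/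
def krausAverage {M : ℕ} (g : Fin M → OneParticle d) (A : Fock d →L[ℂ] Fock d) :
    Fock d →L[ℂ] Fock d :=
  ((4 : ℂ) ^ M)⁻¹ • ∑ α : Fin M → Fin 4, star (wordUnitary g α) * A * wordUnitary g α

theorem lt_of_lt_toNat_min {N i : ℕ} {D : ℕ∞} (h : i < (min (N : ℕ∞) D).toNat) :
    (i : ℕ∞) < D := by
  have h1 : ((min (N : ℕ∞) D).toNat : ℕ∞) ≤ min (N : ℕ∞) D := ENat.natCast_toNat_le_self _
  exact (Nat.cast_lt.2 h).trans_le (h1.trans (min_le_right _ _))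

/-- The averages `𝔼_𝔎^N` over the first `N` vectors of an orthonormal basis `(f_n)_{n < D}` of
`𝔎ᗮ`, where `D ∈ ℕ ∪ {∞}` is the Hilbert space dimension of `𝔎ᗮ`; if `D < N`, then all `D` vectors
are used. -/
def condExpApprox {K : Submodule ℂ (OneParticle d)} {D : ℕ∞}
    (f : HilbertBasis {n : ℕ // (n : ℕ∞) < D} ℂ Kᗮ) (N : ℕ) (A : Fock d →L[ℂ] Fock d) :
    Fock d →L[ℂ] Fock d :=
  krausAverage (M := (min (N : ℕ∞) D).toNat)
    (fun i => (f ⟨i, lt_of_lt_toNat_min i.2⟩ : OneParticle d)) A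

/-- The conditional expectation `𝔼_𝔎(A) = lim_{N → ∞} 𝔼_𝔎^N(A)`, the limit being taken in operator
norm. -/
def condExp {K : Submodule ℂ (OneParticle d)} {D : ℕ∞}
    (f : HilbertBasis {n : ℕ // (n : ℕ∞) < D} ℂ Kᗮ) (A : Fock d →L[ℂ] Fock d) :
    Fock d →L[ℂ] Fock d :=
  limUnder atTop fun N => condExpApprox f N A

end Operators

end Fermion

end

/-!
The argument rests on the canonical anticommutation relations (`annihilation_mul_creation_add`,
`annihilation_mul_annihilation_add`). They are read off the particle sectors, where the adjoint
`a†(g)` is identified with the signed sum over all positions of an inserted particle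
(`sector_creation_succ`, `contract_insertion_succ`).

By these relations `a(g)` and `a†(g)` anticommute with `a(h)` and `a†(h)` when `g` is orthogonal to
`h`, so every operator built from finitely many modes is a sum of an even part, commuting with all
modes orthogonal to them, and an odd part, anticommuting with these modes. The average over one mode
fixes an operator that commutes with the mode and kills one that anticommutes with it, because the
four unitaries then contribute the signs `1, s, s, 1` (`SignCommutes.modeAverage`). The average over
`M + 1` modes is that over the last mode applied to that over the first `M` (`krausAverage_succ`), so
on operators graded with respect to all but finitely many modes the averages are eventually constant.
Such operators form a *-algebra, dense in the CAR algebra because the basis spans the orthogonal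
complement of the subspace and creation and annihilation operators of the subspace itself are odd for
all modes (`carAlgebra_top_le_topologicalClosure`). The averages are contractions, their words being
isometries, so convergence extends to the closure.

An even operator over the subspace commutes with all modes orthogonal to it
(`signCommutes_one_of_mem_evenAlgebra`), hence with each word, and so it can be pulled out of each
average (`krausAverage_mul_mul`) and out of the limit.
-/

noncomputable section

namespace Fermion

section CAR

variable {d n : ℕ}

/-! ### Tensoring and contracting one particle -/

theorem tensor_add_left (f g : OneParticle d) (φ : NParticle d n) :
    tensor (f + g) φ = tensor f φ + tensor g φ := by
  have h0 : Measure.QuasiMeasurePreserving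
      (fun y : Fin (n + 1) → EuclideanSpace ℝ (Fin d) => y 0) volume volume :=
    Measure.quasiMeasurePreserving_eval _ 0
  apply Lp.ext
  filter_upwards [tensor_coeFn (f + g) φ, tensor_coeFn f φ, tensor_coeFn g φ,
    Lp.coeFn_add (tensor f φ) (tensor g φ), h0.ae (Lp.coeFn_add f g)] with y h1 h2 h3 h4 h5
  rw [h1, h4, Pi.add_apply, h2, h3, h5, Pi.add_apply]
  ring

theorem tensor_smul_left (c : ℂ) (f : OneParticle d) (φ : NParticle d n) :
    tensor (c • f) φ = c • tensor f φ := by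
  have h0 : Measure.QuasiMeasurePreserving
      (fun y : Fin (n + 1) → EuclideanSpace ℝ (Fin d) => y 0) volume volume :=
    Measure.quasiMeasurePreserving_eval _ 0
  apply Lp.ext
  filter_upwards [tensor_coeFn (c • f) φ, tensor_coeFn f φ,
    Lp.coeFn_smul c (tensor f φ), h0.ae (Lp.coeFn_smul c f)] with y h1 h2 h3 h4
  rw [h1, h3, Pi.smul_apply, h2, h4, Pi.smul_apply, smul_eq_mul, smul_eq_mul]
  ring

theorem tensor_smul_right (c : ℂ) (f : OneParticle d) (φ : NParticle d n) :
    tensor f (c • φ) = c • tensor f φ := by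
  refine ext_inner_right ℂ fun ψ => ?_
  rw [← inner_contract, inner_smul_left, inner_smul_left, inner_contract]

theorem contract_add_left (f g : OneParticle d) (ψ : NParticle d (n + 1)) :
    contract (f + g) ψ = contract f ψ + contract g ψ := by
  refine ext_inner_left ℂ fun φ => ?_
  rw [inner_add_right, inner_contract, inner_contract, inner_contract, tensor_add_left,
    inner_add_left]

theorem contract_smul_left (c : ℂ) (f : OneParticle d) (ψ : NParticle d (n + 1)) :
    contract (c • f) ψ = (starRingEnd ℂ) c • contract f ψ := by
  refine ext_inner_left ℂ fun φ => ?_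
  rw [inner_smul_right, inner_contract, inner_contract, tensor_smul_left, inner_smul_left]

/-! ### Inserting a particle antisymmetrically -/

/-- The sign of a permutation as a complex number. -/
def signC (σ : Equiv.Perm (Fin n)) : ℂ := ((Equiv.Perm.sign σ : ℤ) : ℂ)

theorem signC_mul (σ τ : Equiv.Perm (Fin n)) : signC (σ * τ) = signC σ * signC τ := by
  simp [signC]

theorem signC_mul_self (σ : Equiv.Perm (Fin n)) : signC σ * signC σ = 1 := by
  rcases Int.units_eq_one_or (Equiv.Perm.sign σ) with h | h <;> simp [signC, h]

theorem conj_signC (σ : Equiv.Perm (Fin n)) : (starRingEnd ℂ) (signC σ) = signC σ := by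
  simp [signC]

/-- The signed sum `∑ₚ sgn(0 p) (0 p)·(g ⊗ φ)` over the positions `p` into which the new particle
can be moved. For antisymmetric `φ` this is `n + 1` times the antisymmetrization of `g ⊗ φ`. -/
def insertion (g : OneParticle d) (φ : NParticle d n) : NParticle d (n + 1) :=
  ∑ p : Fin (n + 1), signC (Equiv.swap 0 p) • permute (Equiv.swap 0 p) (tensor g φ)

theorem decomposeFin_symm_eq (p : Fin (n + 1)) (σ : Equiv.Perm (Fin n)) :
    Equiv.Perm.decomposeFin.symm (p, σ) =
      Equiv.swap 0 p * Equiv.Perm.decomposeFin.symm (0, σ) := by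
  ext i
  refine Fin.cases ?_ (fun j => ?_) i <;> simp

/-- Each permutation of `n + 1` particles is a permutation fixing the first one followed by a
transposition `(0 p)`, and the former only contributes its sign when `φ` is antisymmetric. -/
theorem factorial_smul_insertion (g : OneParticle d) {φ : NParticle d n}
    (hφ : φ ∈ antisymmetric d n) :
    (n.factorial : ℂ) • insertion g φ =
      ∑ π : Equiv.Perm (Fin (n + 1)), signC π • permute π (tensor g φ) := by
  rw [← Equiv.sum_comp Equiv.Perm.decomposeFin.symm, Fintype.sum_prod_type, insertion,
    Finset.smul_sum]
  refine Finset.sum_congr rfl fun p _ => ?_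
  have h : ∀ σ : Equiv.Perm (Fin n),
      signC (Equiv.Perm.decomposeFin.symm (p, σ)) •
        permute (Equiv.Perm.decomposeFin.symm (p, σ)) (tensor g φ) =
      signC (Equiv.swap 0 p) • permute (Equiv.swap 0 p) (tensor g φ) := fun σ => by
    have hs : signC (Equiv.Perm.decomposeFin.symm (0, σ)) = signC σ := by
      simp [signC]
    have hσ : permute σ φ = signC σ • φ := hφ σ
    rw [decomposeFin_symm_eq, permute_mul, permute_tensor, hσ, tensor_smul_right, map_smul,
      signC_mul, hs, smul_smul, mul_assoc, signC_mul_self, mul_one]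
  rw [Finset.sum_congr rfl fun σ _ => h σ, Finset.sum_const, Finset.card_univ, Fintype.card_perm,
    Fintype.card_fin, Nat.cast_smul_eq_nsmul]

theorem insertion_mem (g : OneParticle d) {φ : NParticle d n} (hφ : φ ∈ antisymmetric d n) :
    insertion g φ ∈ antisymmetric d (n + 1) := by
  have h0 : (n.factorial : ℂ) ≠ 0 := Nat.cast_ne_zero.2 n.factorial_ne_zero
  rw [← Submodule.smul_mem_iff _ h0, factorial_smul_insertion g hφ]
  intro τ
  change permute τ _ = signC τ • _
  rw [map_sum, Finset.smul_sum, ← Equiv.sum_comp (Equiv.mulLeft τ)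
    fun π => signC τ • signC π • permute π (tensor g φ)]
  refine Finset.sum_congr rfl fun π _ => ?_
  rw [Equiv.coe_mulLeft, map_smul, permute_mul, signC_mul, smul_smul, ← mul_assoc, signC_mul_self,
    one_mul]

theorem inner_insertion (g : OneParticle d) (φ : NParticle d n) {ψ : NParticle d (n + 1)}
    (hψ : ψ ∈ antisymmetric d (n + 1)) :
    inner ℂ (insertion g φ) ψ = (n + 1) * inner ℂ (tensor g φ) ψ := by
  have h : ∀ p : Fin (n + 1),
      inner ℂ (signC (Equiv.swap 0 p) • permute (Equiv.swap 0 p) (tensor g φ)) ψ =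
        inner ℂ (tensor g φ) ψ := fun p => by
    have h1 : permute (Equiv.swap 0 p) ψ = signC (Equiv.swap 0 p) • ψ := hψ _
    rw [inner_smul_left, conj_signC, ← inner_smul_right, ← h1, LinearIsometry.inner_map_map]
  rw [insertion, sum_inner, Finset.sum_congr rfl fun p _ => h p]
  simp

/-- Contracting a signed transposition of `g ⊗ φ` that moves `g` away from the first slot: the
contraction acts on `φ`, and one sign is lost. -/
theorem contract_permute_swap_succ (f g : OneParticle d) {φ : NParticle d (n + 1)}
    (hφ : φ ∈ antisymmetric d (n + 1)) (q : Fin (n + 1)) :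
    contract f (permute (Equiv.swap 0 q.succ) (tensor g φ)) =
      signC (Equiv.swap 0 q) • permute (Equiv.swap 0 q) (tensor g (contract f φ)) := by
  set ρ : Equiv.Perm (Fin (n + 2)) := Equiv.Perm.decomposeFin.symm (0, Equiv.swap 0 q) with hρ
  have h0 : ρ 0 = 0 := by simp [hρ]
  have h1 : ρ 1 = q.succ := by
    rw [hρ, Equiv.Perm.decomposeFin_symm_apply_one]
    simp
  have hρρ : ρ⁻¹ = ρ := by
    rw [inv_eq_iff_mul_eq_one]
    ext i
    refine Fin.cases ?_ (fun j => ?_) i <;> simp [hρ]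
  -- conjugation by `ρ`, which fixes the first particle, turns `(0 1)` into `(0 q+1)`
  have hs : Equiv.swap 0 q.succ = ρ * (Equiv.swap 0 1 * ρ) := by
    have := Equiv.swap_apply_apply ρ 0 1
    rw [h0, h1, hρρ] at this
    rw [this, mul_assoc]
  have hφq : permute (Equiv.swap 0 q) φ = signC (Equiv.swap 0 q) • φ := hφ _
  rw [hs, permute_mul, permute_mul, hρ, contract_permute, permute_tensor, hφq, tensor_smul_right,
    map_smul, map_smul, contract_swap_tensor, map_smul]

theorem contract_insertion_zero (f g : OneParticle d) (φ : NParticle d 0) :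
    contract f (insertion g φ) = inner ℂ f g • φ := by
  have : insertion g φ = tensor g φ := by
    simp [insertion, signC, ← Equiv.Perm.one_def, permute_one]
  rw [this]
  exact contract₀_tensor f g φ

theorem contract_insertion_succ (f g : OneParticle d) {φ : NParticle d (n + 1)}
    (hφ : φ ∈ antisymmetric d (n + 1)) :
    contract f (insertion g φ) = inner ℂ f g • φ - insertion g (contract f φ) := by
  have h0 : contract f (tensor g φ) = inner ℂ f g • φ := contract₀_tensor f g φ
  rw [insertion, map_sum, Fin.sum_univ_succ, insertion, sub_eq_add_neg, ← Finset.sum_neg_distrib]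
  congr 1
  · simp [signC, ← Equiv.Perm.one_def, permute_one, h0]
  · refine Finset.sum_congr rfl fun q _ => ?_
    have hs : signC (Equiv.swap 0 q.succ) = -1 := by
      simp [signC, Equiv.Perm.sign_swap (Fin.succ_ne_zero q).symm]
    rw [map_smul, contract_permute_swap_succ f g hφ, hs, neg_one_smul]

/-! ### The canonical anticommutation relations on Fock space -/

namespace Fock

theorem ext_sector {ψ φ : Fock d} (h : ∀ n, (ψ.sector n : NParticle d n) = φ.sector n) : ψ = φ :=
  Subtype.ext <| funext fun n => Subtype.ext (h n)

theorem sector_add (ψ φ : Fock d) (n : ℕ) :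
    ((ψ + φ).sector n : NParticle d n) = ψ.sector n + φ.sector n := rfl

theorem sector_smul (c : ℂ) (ψ : Fock d) (n : ℕ) :
    ((c • ψ).sector n : NParticle d n) = c • (ψ.sector n : NParticle d n) := rfl

/-- The Fock space vector whose only component is `η`, in the `n`-particle sector. -/
def single (n : ℕ) (η : antisymmetric d n) : Fock d :=
  lp.single (E := fun n => antisymmetric d n) 2 n η

theorem inner_single_left (η : antisymmetric d n) (ψ : Fock d) :
    inner ℂ (single n η) ψ = inner ℂ (η : NParticle d n) (ψ.sector n : NParticle d n) :=
  lp.inner_single_left (G := fun n => antisymmetric d n) (𝕜 := ℂ) n η ψ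

theorem sector_single_self (η : antisymmetric d n) : (single n η).sector n = η :=
  lp.single_apply_self (E := fun n => antisymmetric d n) 2 n η

theorem sector_single_of_ne (η : antisymmetric d n) {m : ℕ} (h : m ≠ n) :
    (single n η).sector m = 0 :=
  lp.single_apply_ne (E := fun n => antisymmetric d n) 2 n η h

end Fock

theorem sector_annihilation (f : OneParticle d) (ψ : Fock d) (n : ℕ) :
    ((annihilation f ψ).sector n : NParticle d n) =
      (Real.sqrt (n + 1) : ℂ) • contract f (ψ.sector (n + 1) : NParticle d (n + 1)) := rfl

theorem annihilation_single_succ (f : OneParticle d) (η : antisymmetric d (n + 1)) :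
    annihilation f (Fock.single (n + 1) η) = Fock.single n (annihilationSector f n η) := by
  refine Fock.ext_sector fun m => congrArg Subtype.val ?_
  change annihilationSector f m ((Fock.single (n + 1) η).sector (m + 1)) = _
  by_cases h : m = n
  · subst h
    rw [Fock.sector_single_self, Fock.sector_single_self]
  · rw [Fock.sector_single_of_ne _ h, Fock.sector_single_of_ne _ (by simpa using h), map_zero]

theorem annihilation_single_zero (f : OneParticle d) (η : antisymmetric d 0) :
    annihilation f (Fock.single 0 η) = 0 := by
  refine Fock.ext_sector fun m => congrArg Subtype.val ?_
  change annihilationSector f m ((Fock.single 0 η).sector (m + 1)) = 0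
  rw [Fock.sector_single_of_ne _ (Nat.succ_ne_zero m), map_zero]

theorem inner_creation (g : OneParticle d) (φ ψ : Fock d) :
    inner ℂ φ (creation g ψ) = inner ℂ (annihilation g φ) ψ := by
  rw [creation, ContinuousLinearMap.star_eq_adjoint, ContinuousLinearMap.adjoint_inner_right]

theorem ofReal_sqrt_mul_self (n : ℕ) :
    (Real.sqrt (n + 1) : ℂ) * (Real.sqrt (n + 1) : ℂ) = n + 1 := by
  rw [← Complex.ofReal_mul, Real.mul_self_sqrt (by positivity)]
  simp

theorem ofReal_sqrt_ne_zero (n : ℕ) : (Real.sqrt (n + 1) : ℂ) ≠ 0 :=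
  Complex.ofReal_ne_zero.2 (Real.sqrt_ne_zero'.2 (by positivity))

theorem sector_creation_zero (g : OneParticle d) (ψ : Fock d) :
    ((creation g ψ).sector 0 : NParticle d 0) = 0 := by
  have h := Fock.inner_single_left ((creation g ψ).sector 0) (creation g ψ)
  rw [inner_creation, annihilation_single_zero, inner_zero_left] at h
  exact inner_self_eq_zero.1 h.symm

/-- The creation operator, defined as an adjoint, inserts a particle:
`(a†(g)ψ)⁽ⁿ⁺¹⁾ = (n + 1)^{-1/2} ∑ₚ sgn(0 p) (0 p)·(g ⊗ ψ⁽ⁿ⁾)`. -/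
theorem sector_creation_succ (g : OneParticle d) (ψ : Fock d) (n : ℕ) :
    ((creation g ψ).sector (n + 1) : NParticle d (n + 1)) =
      (Real.sqrt (n + 1) : ℂ)⁻¹ • insertion g (ψ.sector n : NParticle d n) := by
  let χ : antisymmetric d (n + 1) := (Real.sqrt (n + 1) : ℂ)⁻¹ •
    ⟨insertion g (ψ.sector n : NParticle d n), insertion_mem g (ψ.sector n).2⟩
  refine congrArg Subtype.val (?_ : (creation g ψ).sector (n + 1) = χ)
  refine ext_inner_left ℂ fun η => ?_
  have h := Fock.inner_single_left η (creation g ψ)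
  rw [inner_creation, annihilation_single_succ, Fock.inner_single_left] at h
  refine h.symm.trans ?_
  change inner ℂ ((Real.sqrt (n + 1) : ℂ) • contract g (η : NParticle d (n + 1))) _ =
    inner ℂ (η : NParticle d (n + 1)) ((Real.sqrt (n + 1) : ℂ)⁻¹ • insertion g _)
  have h1 := congrArg (starRingEnd ℂ) (inner_insertion g (ψ.sector n : NParticle d n) η.2)
  rw [inner_conj_symm, map_mul, ← inner_contract, inner_conj_symm] at h1
  rw [inner_smul_left, inner_smul_right, h1, Complex.conj_ofReal]
  have h2 : (starRingEnd ℂ) ((n : ℂ) + 1) = n + 1 := by simp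
  rw [h2, ← ofReal_sqrt_mul_self, ← mul_assoc, inv_mul_cancel_left₀ (ofReal_sqrt_ne_zero n)]

/-- The canonical anticommutation relation `a(f) a†(g) + a†(g) a(f) = ⟨f, g⟩`. -/
theorem annihilation_mul_creation_add (f g : OneParticle d) :
    annihilation f * creation g + creation g * annihilation f = inner ℂ f g • 1 := by
  ext1 ψ
  refine Fock.ext_sector fun n => ?_
  change ((annihilation f (creation g ψ) + creation g (annihilation f ψ)).sector n :
    NParticle d n) = inner ℂ f g • (ψ.sector n : NParticle d n)
  have h1 : ((annihilation f (creation g ψ)).sector n : NParticle d n) =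
      contract f (insertion g (ψ.sector n : NParticle d n)) := by
    rw [sector_annihilation, sector_creation_succ, map_smul,
      smul_inv_smul₀ (ofReal_sqrt_ne_zero n)]
  rw [Fock.sector_add, h1]
  rcases n with _ | n
  · rw [contract_insertion_zero, sector_creation_zero, add_zero]
  · have h2 : ∀ (c : ℂ) (φ : NParticle d n), insertion g (c • φ) = c • insertion g φ := by
      intro c φ
      simp only [insertion, tensor_smul_right, map_smul, Finset.smul_sum]
      exact Finset.sum_congr rfl fun p _ => smul_comm _ _ _
    rw [contract_insertion_succ f g (ψ.sector (n + 1)).2, sector_creation_succ,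
      sector_annihilation, h2, inv_smul_smul₀ (ofReal_sqrt_ne_zero n), sub_add_cancel]

theorem annihilation_mul_self (f : OneParticle d) : annihilation f * annihilation f = 0 := by
  ext1 ψ
  refine Fock.ext_sector fun n => ?_
  change ((annihilation f (annihilation f ψ)).sector n : NParticle d n) = 0
  rw [sector_annihilation, sector_annihilation, map_smul,
    contract_contract f (ψ.sector (n + 2)).2, smul_zero, smul_zero]

theorem annihilation_add (f g : OneParticle d) :
    annihilation (f + g) = annihilation f + annihilation g := by
  ext1 ψ
  refine Fock.ext_sector fun n => ?_
  rw [add_apply, Fock.sector_add, sector_annihilation, sector_annihilation,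
    sector_annihilation, contract_add_left, smul_add]

theorem annihilation_smul (c : ℂ) (f : OneParticle d) :
    annihilation (c • f) = (starRingEnd ℂ) c • annihilation f := by
  ext1 ψ
  refine Fock.ext_sector fun n => ?_
  rw [smul_apply, Fock.sector_smul, sector_annihilation, sector_annihilation,
    contract_smul_left, smul_comm]

theorem annihilation_zero : annihilation (0 : OneParticle d) = 0 := by
  simpa using annihilation_smul 0 (0 : OneParticle d)

theorem norm_annihilation_le (f : OneParticle d) : ‖annihilation f‖ ≤ ‖f‖ :=
  LinearMap.mkContinuous_norm_le _ (norm_nonneg _) _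

/-- The canonical anticommutation relation `a(f) a(g) + a(g) a(f) = 0`, by polarization of
`a(f)² = 0`. -/
theorem annihilation_mul_annihilation_add (f g : OneParticle d) :
    annihilation f * annihilation g + annihilation g * annihilation f = 0 := by
  have h := annihilation_mul_self (f + g)
  rw [annihilation_add, mul_add, add_mul, add_mul, annihilation_mul_self, annihilation_mul_self,
    zero_add, add_zero] at h
  rw [add_comm, h]

end CAR

/-! ### Parity with respect to a mode -/

section Parity

variable {d : ℕ}

theorem star_annihilation (f : OneParticle d) : star (annihilation f) = creation f := rfl

theorem star_creation (f : OneParticle d) : star (creation f) = annihilation f :=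
  star_star (annihilation f)

/-- `A` commutes with `a(h)` and `a†(h)` up to the sign `s`, where `s = 1` or `s = -1`. Even
elements built from modes orthogonal to `h` have `s = 1`, odd ones have `s = -1`. -/
def SignCommutes (s : ℤ) (h : OneParticle d) (A : Fock d →L[ℂ] Fock d) : Prop :=
  A * annihilation h = s • (annihilation h * A) ∧ A * creation h = s • (creation h * A)

namespace SignCommutes

variable {s t : ℤ} {h : OneParticle d} {A B : Fock d →L[ℂ] Fock d}

theorem zero : SignCommutes s h 0 := by simp [SignCommutes]

theorem one : SignCommutes 1 h 1 := by simp [SignCommutes]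

theorem add (hA : SignCommutes s h A) (hB : SignCommutes s h B) : SignCommutes s h (A + B) := by
  constructor
  · rw [add_mul, mul_add, smul_add, hA.1, hB.1]
  · rw [add_mul, mul_add, smul_add, hA.2, hB.2]

theorem smul (c : ℂ) (hA : SignCommutes s h A) : SignCommutes s h (c • A) := by
  constructor
  · rw [smul_mul_assoc, mul_smul_comm, hA.1, smul_comm]
  · rw [smul_mul_assoc, mul_smul_comm, hA.2, smul_comm]

theorem neg (hA : SignCommutes s h A) : SignCommutes s h (-A) := by
  simpa using hA.smul (-1)

theorem sub (hA : SignCommutes s h A) (hB : SignCommutes s h B) : SignCommutes s h (A - B) := by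
  simpa [sub_eq_add_neg] using hA.add hB.neg

theorem sum {ι : Type*} (S : Finset ι) {X : ι → Fock d →L[ℂ] Fock d}
    (hX : ∀ i ∈ S, SignCommutes s h (X i)) : SignCommutes s h (∑ i ∈ S, X i) :=
  Finset.sum_induction _ _ (fun _ _ => add) zero hX

theorem mul (hA : SignCommutes s h A) (hB : SignCommutes t h B) :
    SignCommutes (s * t) h (A * B) := by
  constructor
  · rw [mul_assoc, hB.1, mul_smul_comm, ← mul_assoc, hA.1, smul_mul_assoc, smul_smul, mul_comm t,
      mul_assoc]
  · rw [mul_assoc, hB.2, mul_smul_comm, ← mul_assoc, hA.2, smul_mul_assoc, smul_smul, mul_comm t,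
      mul_assoc]

protected theorem star (hs : s * s = 1) (hA : SignCommutes s h A) :
    SignCommutes s h (star A) := by
  have h1 := congrArg star hA.1
  have h2 := congrArg star hA.2
  rw [star_mul, star_zsmul, star_mul, star_annihilation] at h1
  rw [star_mul, star_zsmul, star_mul, star_creation] at h2
  constructor
  · rw [h2, smul_smul, hs, one_smul]
  · rw [h1, smul_smul, hs, one_smul]

end SignCommutes

theorem signCommutes_annihilation {g h : OneParticle d} (hgh : inner ℂ g h = 0) :
    SignCommutes (-1) h (annihilation g) := by
  have h1 := annihilation_mul_creation_add g h
  rw [hgh, zero_smul] at h1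
  constructor
  · rw [neg_one_smul]
    exact eq_neg_of_add_eq_zero_left (annihilation_mul_annihilation_add g h)
  · rw [neg_one_smul]
    exact eq_neg_of_add_eq_zero_left h1

theorem signCommutes_creation {g h : OneParticle d} (hgh : inner ℂ g h = 0) :
    SignCommutes (-1) h (creation g) :=
  (signCommutes_annihilation hgh).star (by norm_num)

/-- The sign with which the `i`-th mode unitary commutes with operators of other modes. -/
def modeSign : Fin 4 → ℤ := ![1, -1, -1, 1]

theorem signCommutes_modeUnitary {g h : OneParticle d} (hgh : inner ℂ g h = 0) (i : Fin 4) :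
    SignCommutes (modeSign i) h (modeUnitary g i) := by
  have ha := signCommutes_annihilation hgh
  have hc := signCommutes_creation hgh
  fin_cases i
  · exact SignCommutes.one
  · exact hc.add ha
  · exact hc.sub ha
  · exact SignCommutes.one.sub ((hc.mul ha).smul 2)

theorem exists_signCommutes_wordUnitary {M : ℕ} (g : Fin M → OneParticle d) {h : OneParticle d}
    (hgh : ∀ i, inner ℂ (g i) h = 0) (α : Fin M → Fin 4) :
    ∃ t : ℤ, t * t = 1 ∧ SignCommutes t h (wordUnitary g α) := by
  refine List.prod_induction
    (fun X : Fock d →L[ℂ] Fock d => ∃ t : ℤ, t * t = 1 ∧ SignCommutes t h X) ?_ ?_ ?_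
  · rintro A B ⟨s, hs, hA⟩ ⟨t, ht, hB⟩
    exact ⟨s * t, by rw [mul_mul_mul_comm, hs, ht, one_mul], hA.mul hB⟩
  · exact ⟨1, one_mul 1, SignCommutes.one⟩
  · intro X hX
    obtain ⟨i, rfl⟩ := List.mem_ofFn.1 hX
    refine ⟨modeSign (α i), ?_, signCommutes_modeUnitary (hgh i) (α i)⟩
    generalize α i = j
    fin_cases j <;> rfl

/-- Averaging over other modes preserves the parity, since the sign of each word occurs twice. -/
theorem SignCommutes.krausAverage {M : ℕ} (g : Fin M → OneParticle d) {h : OneParticle d}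
    (hgh : ∀ i, inner ℂ (g i) h = 0) {s : ℤ} {A : Fock d →L[ℂ] Fock d}
    (hA : SignCommutes s h A) : SignCommutes s h (krausAverage g A) := by
  refine SignCommutes.smul _ (SignCommutes.sum _ fun α _ => ?_)
  obtain ⟨t, ht, hw⟩ := exists_signCommutes_wordUnitary g hgh α
  have h1 := ((hw.star ht).mul hA).mul hw
  rwa [mul_right_comm, ht, one_mul] at h1

/-! ### Conjugation by the unitaries of one mode -/

section Unitarity

variable {h : OneParticle d}

theorem annihilation_mul_creation_of_norm_eq_one (hh : ‖h‖ = 1) :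
    annihilation h * creation h = 1 - creation h * annihilation h := by
  have h1 := annihilation_mul_creation_add h h
  rw [inner_self_eq_norm_sq_to_K, hh] at h1
  rw [eq_sub_iff_add_eq, h1]
  simp

theorem creation_mul_self (f : OneParticle d) : creation f * creation f = 0 := by
  have h := congrArg star (annihilation_mul_self f)
  rwa [star_mul, star_zero] at h

theorem star_modeUnitary_mul_self (hh : ‖h‖ = 1) (i : Fin 4) :
    star (modeUnitary h i) * modeUnitary h i = 1 := by
  have haa := annihilation_mul_self h
  have hcc := creation_mul_self h
  have hac := annihilation_mul_creation_of_norm_eq_one hh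
  fin_cases i
  · change star (1 : Fock d →L[ℂ] Fock d) * 1 = 1
    simp
  · change star (creation h + annihilation h) * (creation h + annihilation h) = 1
    rw [star_add, star_creation, star_annihilation, add_mul, mul_add, mul_add, haa, hcc, hac]
    abel
  · change star (creation h - annihilation h) * (creation h - annihilation h) = 1
    rw [star_sub, star_creation, star_annihilation, sub_mul, mul_sub, mul_sub, haa, hcc, hac]
    abel
  · change star (1 - (2 : ℂ) • (creation h * annihilation h)) *
      (1 - (2 : ℂ) • (creation h * annihilation h)) = 1
    have hN : creation h * annihilation h * (creation h * annihilation h) =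
        creation h * annihilation h := by
      rw [mul_assoc, ← mul_assoc (annihilation h), hac, sub_mul, mul_assoc (creation h), haa,
        mul_zero, one_mul, sub_zero]
    have h2 : star (2 : ℂ) = 2 := Complex.conj_ofNat 2
    rw [star_sub, star_one, star_smul, star_mul, star_creation, star_annihilation, h2, mul_sub,
      mul_one, sub_mul, one_mul, smul_mul_smul_comm, hN]
    module

theorem SignCommutes.mul_modeUnitary {A : Fock d →L[ℂ] Fock d} {s : ℤ} (hs : s * s = 1)
    (hA : SignCommutes s h A) (i : Fin 4) :
    A * modeUnitary h i = (![1, s, s, 1] i) • (modeUnitary h i * A) := by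
  obtain ⟨ha, hc⟩ := hA
  fin_cases i
  · change A * 1 = (1 : ℤ) • (1 * A)
    simp
  · change A * (creation h + annihilation h) = s • ((creation h + annihilation h) * A)
    rw [mul_add, add_mul, smul_add, ha, hc]
  · change A * (creation h - annihilation h) = s • ((creation h - annihilation h) * A)
    rw [mul_sub, sub_mul, smul_sub, ha, hc]
  · change A * (1 - (2 : ℂ) • (creation h * annihilation h)) =
      (1 : ℤ) • ((1 - (2 : ℂ) • (creation h * annihilation h)) * A)
    rw [mul_sub, sub_mul, mul_one, one_mul, one_smul, mul_smul_comm, smul_mul_assoc, ← mul_assoc,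
      hc, smul_mul_assoc, mul_assoc, ha, mul_smul_comm, smul_smul, hs, one_smul, mul_assoc]

theorem SignCommutes.conj_modeUnitary {A : Fock d →L[ℂ] Fock d} {s : ℤ} (hs : s * s = 1)
    (hh : ‖h‖ = 1) (hA : SignCommutes s h A) (i : Fin 4) :
    star (modeUnitary h i) * A * modeUnitary h i = (![1, s, s, 1] i) • A := by
  rw [mul_assoc, hA.mul_modeUnitary hs, mul_smul_comm, ← mul_assoc,
    star_modeUnitary_mul_self hh, one_mul]

/-- The average over a single mode fixes the operators commuting with it and kills those
anticommuting with it, as the signs are `1, s, s, 1`. -/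
theorem SignCommutes.modeAverage {A : Fock d →L[ℂ] Fock d} {s : ℤ} (hs : s * s = 1)
    (hh : ‖h‖ = 1) (hA : SignCommutes s h A) :
    (4 : ℂ)⁻¹ • ∑ i, star (modeUnitary h i) * A * modeUnitary h i =
      ((1 + s : ℂ) / 2) • A := by
  rw [Finset.sum_congr rfl fun i _ => hA.conj_modeUnitary hs hh i, Fin.sum_univ_four]
  change (4 : ℂ)⁻¹ • ((1 : ℤ) • A + s • A + s • A + (1 : ℤ) • A) = _
  simp only [← Int.cast_smul_eq_zsmul ℂ]
  module

theorem wordUnitary_succ {M : ℕ} (g : Fin (M + 1) → OneParticle d) (α : Fin (M + 1) → Fin 4) :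
    wordUnitary g α = wordUnitary (fun i => g i.castSucc) (fun i => α i.castSucc) *
      modeUnitary (g (Fin.last M)) (α (Fin.last M)) := by
  rw [wordUnitary, List.ofFn_succ', List.prod_concat]
  rfl

theorem star_wordUnitary_mul_self {M : ℕ} (g : Fin M → OneParticle d) (hg : ∀ i, ‖g i‖ = 1)
    (α : Fin M → Fin 4) : star (wordUnitary g α) * wordUnitary g α = 1 := by
  induction M with
  | zero => simp [wordUnitary]
  | succ M ih =>
    rw [wordUnitary_succ, star_mul, mul_assoc, ← mul_assoc (star (wordUnitary _ _)),
      ih _ fun i => hg i.castSucc, one_mul, star_modeUnitary_mul_self (hg _)]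

theorem norm_wordUnitary_le {M : ℕ} (g : Fin M → OneParticle d) (hg : ∀ i, ‖g i‖ = 1)
    (α : Fin M → Fin 4) : ‖wordUnitary g α‖ ≤ 1 := by
  have h1 := CStarRing.norm_star_mul_self (x := wordUnitary g α)
  rw [star_wordUnitary_mul_self g hg] at h1
  have h2 : ‖(1 : Fock d →L[ℂ] Fock d)‖ ≤ 1 := ContinuousLinearMap.norm_id_le
  nlinarith [norm_nonneg (wordUnitary g α)]

end Unitarity

/-! ### Averages over several modes -/

section Average

variable {M : ℕ} (g : Fin M → OneParticle d)

theorem krausAverage_add (A B : Fock d →L[ℂ] Fock d) :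
    krausAverage g (A + B) = krausAverage g A + krausAverage g B := by
  simp only [krausAverage, mul_add, add_mul, Finset.sum_add_distrib, smul_add]

theorem krausAverage_sub (A B : Fock d →L[ℂ] Fock d) :
    krausAverage g (A - B) = krausAverage g A - krausAverage g B := by
  simp only [krausAverage, mul_sub, sub_mul, Finset.sum_sub_distrib, smul_sub]

theorem norm_krausAverage_le (hg : ∀ i, ‖g i‖ = 1) (A : Fock d →L[ℂ] Fock d) :
    ‖krausAverage g A‖ ≤ ‖A‖ := by
  have h : ∀ α : Fin M → Fin 4, ‖star (wordUnitary g α) * A * wordUnitary g α‖ ≤ ‖A‖ := fun α => by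
    have hw := norm_wordUnitary_le g hg α
    calc _ ≤ ‖star (wordUnitary g α)‖ * ‖A‖ * ‖wordUnitary g α‖ :=
          (norm_mul_le _ _).trans (by gcongr; exact norm_mul_le _ _)
      _ ≤ 1 * ‖A‖ * 1 := by
          rw [norm_star]
          gcongr
      _ = ‖A‖ := by ring
  rw [krausAverage, norm_smul, norm_inv, norm_pow]
  have h4 : ‖(4 : ℂ)‖ = 4 := by simp
  rw [h4, inv_mul_le_iff₀ (by positivity)]
  refine (norm_sum_le_of_le _ fun α _ => h α).trans (le_of_eq ?_)
  simp

/-- The average over `M + 1` modes is the average over the last mode applied to the average over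
the first `M` modes. -/
theorem krausAverage_succ (g : Fin (M + 1) → OneParticle d) (A : Fock d →L[ℂ] Fock d) :
    krausAverage g A = (4 : ℂ)⁻¹ • ∑ i, star (modeUnitary (g (Fin.last M)) i) *
      krausAverage (fun i => g i.castSucc) A * modeUnitary (g (Fin.last M)) i := by
  simp only [krausAverage, mul_smul_comm, smul_mul_assoc, ← Finset.smul_sum, smul_smul]
  rw [pow_succ, mul_inv, mul_comm]
  congr 1
  rw [← (Fin.snocEquiv fun _ : Fin (M + 1) => Fin 4).sum_comp, Fintype.sum_prod_type]
  refine Finset.sum_congr rfl fun i _ => ?_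
  rw [Finset.mul_sum, Finset.sum_mul]
  refine Finset.sum_congr rfl fun α _ => ?_
  rw [wordUnitary_succ, star_mul]
  simp only [Fin.snocEquiv_apply, Fin.snoc_castSucc, Fin.snoc_last, mul_assoc]

theorem SignCommutes.krausAverage_succ_eq (g : Fin (M + 1) → OneParticle d)
    (hg : ‖g (Fin.last M)‖ = 1) (horth : ∀ i : Fin M, inner ℂ (g i.castSucc) (g (Fin.last M)) = 0)
    {s : ℤ} (hs : s * s = 1) {A : Fock d →L[ℂ] Fock d} (hA : SignCommutes s (g (Fin.last M)) A) :
    Fermion.krausAverage g A =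
      ((1 + s : ℂ) / 2) • Fermion.krausAverage (fun i => g i.castSucc) A := by
  rw [Fermion.krausAverage_succ]
  exact (hA.krausAverage _ horth).modeAverage hs hg

/-- Operators commuting with all modes in the average pass through it. -/
theorem krausAverage_mul_mul {B C : Fock d →L[ℂ] Fock d} (hB : ∀ i, SignCommutes 1 (g i) B)
    (hC : ∀ i, SignCommutes 1 (g i) C) (A : Fock d →L[ℂ] Fock d) :
    krausAverage g (B * A * C) = B * krausAverage g A * C := by
  have key : ∀ {X : Fock d →L[ℂ] Fock d}, (∀ i, SignCommutes 1 (g i) X) → ∀ α,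
      Commute X (wordUnitary g α) := by
    intro X hX α
    refine Commute.list_prod_right _ _ fun y hy => ?_
    obtain ⟨i, rfl⟩ := List.mem_ofFn.1 hy
    have h := (hX i).mul_modeUnitary (one_mul 1) (α i)
    have h1 : (![1, 1, 1, 1] : Fin 4 → ℤ) (α i) = 1 := by
      generalize α i = j
      fin_cases j <;> rfl
    rw [h1, one_smul] at h
    exact h
  rw [krausAverage, krausAverage, mul_smul_comm, smul_mul_assoc, Finset.mul_sum, Finset.sum_mul]
  congr 1
  refine Finset.sum_congr rfl fun α _ => ?_
  have hB' : star (wordUnitary g α) * B = B * star (wordUnitary g α) := by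
    have := congrArg star (key (fun i => (hB i).star (one_mul 1)) α).eq
    simpa using this
  have hC' : C * wordUnitary g α = wordUnitary g α * C := key hC α
  calc star (wordUnitary g α) * (B * A * C) * wordUnitary g α
      = star (wordUnitary g α) * B * A * (C * wordUnitary g α) := by simp only [mul_assoc]
    _ = _ := by
        rw [hB', hC']
        simp only [mul_assoc]

end Average

end Parity

/-! ### Norm convergence of the averages on the CAR algebra -/

section Convergence

variable {d : ℕ}

/-- Operators `P + Q` where, for all but finitely many modes `F n`, the summand `P` commutes and `Q`
anticommutes with `a(F n)` and `a†(F n)`. They form a unital *-algebra. -/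
def eventuallyGraded (F : ℕ → OneParticle d) : StarSubalgebra ℂ (Fock d →L[ℂ] Fock d) where
  carrier := {A | ∃ (m : ℕ) (P Q : Fock d →L[ℂ] Fock d), A = P + Q ∧
    ∀ n, m ≤ n → SignCommutes 1 (F n) P ∧ SignCommutes (-1) (F n) Q}
  mul_mem' := by
    rintro _ _ ⟨m, P, Q, rfl, h⟩ ⟨m', P', Q', rfl, h'⟩
    refine ⟨max m m', P * P' + Q * Q', P * Q' + Q * P', ?_, fun n hn => ?_⟩
    · rw [add_mul, mul_add, mul_add]
      abel
    · obtain ⟨hP, hQ⟩ := h n (le_trans (le_max_left _ _) hn)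
      obtain ⟨hP', hQ'⟩ := h' n (le_trans (le_max_right _ _) hn)
      exact ⟨(hP.mul hP').add (hQ.mul hQ'), (hP.mul hQ').add (hQ.mul hP')⟩
  add_mem' := by
    rintro _ _ ⟨m, P, Q, rfl, h⟩ ⟨m', P', Q', rfl, h'⟩
    refine ⟨max m m', P + P', Q + Q', by abel, fun n hn => ?_⟩
    obtain ⟨hP, hQ⟩ := h n (le_trans (le_max_left _ _) hn)
    obtain ⟨hP', hQ'⟩ := h' n (le_trans (le_max_right _ _) hn)
    exact ⟨hP.add hP', hQ.add hQ'⟩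
  algebraMap_mem' c := by
    refine ⟨0, c • 1, 0, ?_, fun n _ => ⟨SignCommutes.one.smul c, SignCommutes.zero⟩⟩
    rw [Algebra.algebraMap_eq_smul_one, add_zero]
  star_mem' := by
    rintro _ ⟨m, P, Q, rfl, h⟩
    exact ⟨m, star P, star Q, star_add _ _, fun n hn =>
      ⟨(h n hn).1.star (by norm_num), (h n hn).2.star (by norm_num)⟩⟩

theorem annihilation_mem_eventuallyGraded {F : ℕ → OneParticle d} {h : OneParticle d} (m : ℕ)
    (hF : ∀ n, m ≤ n → inner ℂ h (F n) = 0) : annihilation h ∈ eventuallyGraded F :=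
  ⟨m, 0, annihilation h, (zero_add _).symm, fun n hn =>
    ⟨SignCommutes.zero, signCommutes_annihilation (hF n hn)⟩⟩

/-- The subspace of the one-particle vectors `h` with `a(h)` in a given *-algebra of operators. -/
def annihilationComap (S : StarSubalgebra ℂ (Fock d →L[ℂ] Fock d)) :
    Submodule ℂ (OneParticle d) where
  carrier := {h | annihilation h ∈ S}
  add_mem' hf hg := by
    change annihilation _ ∈ S
    rw [annihilation_add]
    exact add_mem hf hg
  zero_mem' := by
    change annihilation _ ∈ S
    rw [annihilation_zero]
    exact zero_mem S
  smul_mem' c f hf := by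
    change annihilation _ ∈ S
    rw [annihilation_smul]
    exact S.smul_mem hf _

theorem continuous_annihilation :
    Continuous (annihilation : OneParticle d → (Fock d →L[ℂ] Fock d)) :=
  AddMonoidHomClass.continuous_of_bound
    (⟨⟨annihilation, annihilation_zero⟩, annihilation_add⟩ :
      OneParticle d →+ (Fock d →L[ℂ] Fock d)) 1
    fun f => by simpa using norm_annihilation_le f

theorem isClosed_annihilationComap {S : StarSubalgebra ℂ (Fock d →L[ℂ] Fock d)}
    (hS : IsClosed (S : Set (Fock d →L[ℂ] Fock d))) :
    IsClosed (annihilationComap S : Set (OneParticle d)) :=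
  hS.preimage continuous_annihilation

/-- If the orthonormal modes `F n` span `Kᗮ`, the operators that are graded with respect to all but
finitely many of them are dense in the CAR algebra. -/
theorem carAlgebra_top_le_topologicalClosure {K : Submodule ℂ (OneParticle d)}
    (hK : IsClosed (K : Set (OneParticle d))) {F : ℕ → OneParticle d} (hF : Orthonormal ℂ F)
    (hFK : ∀ n, F n ∈ Kᗮ) (hspan : Kᗮ ≤ (Submodule.span ℂ (Set.range F)).topologicalClosure) :
    carAlgebra (⊤ : Submodule ℂ (OneParticle d)) ≤ (eventuallyGraded F).topologicalClosure := by
  have hcl : IsClosed ((eventuallyGraded F).topologicalClosure : Set (Fock d →L[ℂ] Fock d)) :=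
    StarSubalgebra.isClosed_topologicalClosure _
  refine StarSubalgebra.topologicalClosure_minimal (StarAlgebra.adjoin_le ?_) hcl
  rintro _ ⟨h, -, rfl⟩
  suffices htop : (⊤ : Submodule ℂ (OneParticle d)) ≤
      annihilationComap (eventuallyGraded F).topologicalClosure from
    htop Submodule.mem_top
  have : CompleteSpace K := hK.completeSpace_coe
  rw [← Submodule.sup_orthogonal_of_hasOrthogonalProjection (K := K)]
  refine sup_le (fun k hk => ?_) (hspan.trans (Submodule.topologicalClosure_minimal _
    (Submodule.span_le.2 ?_) (isClosed_annihilationComap hcl)))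
  · exact StarSubalgebra.le_topologicalClosure _
      (annihilation_mem_eventuallyGraded 0 fun n _ => hFK n k hk)
  · rintro _ ⟨j, rfl⟩
    exact StarSubalgebra.le_topologicalClosure _
      (annihilation_mem_eventuallyGraded (j + 1) fun n hn => hF.2 (by omega))

/-- For graded operators the averages are eventually constant: a further mode fixes the even part
and kills the odd part. -/
theorem exists_krausAverage_eq_of_mem_eventuallyGraded {F : ℕ → OneParticle d}
    (hF : Orthonormal ℂ F) {A : Fock d →L[ℂ] Fock d} (hA : A ∈ eventuallyGraded F) :
    ∃ (m : ℕ) (L : Fock d →L[ℂ] Fock d), ∀ N, m ≤ N →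
      krausAverage (fun i : Fin N => F i) A = L := by
  obtain ⟨m, P, Q, rfl, h⟩ := hA
  have hnorm : ∀ N, ‖F N‖ = 1 := hF.1
  have horth : ∀ N (i : Fin N), inner ℂ (F i) (F N) = 0 := fun N i => hF.2 i.2.ne
  refine ⟨m + 1, krausAverage (fun i : Fin m => F i) P, fun N hN => ?_⟩
  have hQ : ∀ N, m ≤ N → krausAverage (fun i : Fin (N + 1) => F i) Q = 0 := fun N hN => by
    have h1 := (h N hN).2.krausAverage_succ_eq (fun i : Fin (N + 1) => F i) (hnorm N) (horth N)
      (by norm_num)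
    rw [h1]
    simp
  have hP : krausAverage (fun i : Fin N => F i) P = krausAverage (fun i : Fin m => F i) P := by
    refine Nat.le_induction rfl (fun N hN ih => ?_) N (Nat.le_of_succ_le hN)
    have h1 := (h N hN).1.krausAverage_succ_eq (fun i : Fin (N + 1) => F i) (hnorm N) (horth N)
      (by norm_num)
    rw [h1, ← ih]
    norm_num
  obtain ⟨k, rfl⟩ : ∃ k, N = k + 1 := ⟨N - 1, by omega⟩
  rw [krausAverage_add, hP, hQ k (by omega), add_zero]

/-- Uniform contractivity carries convergence of the averages from a set to its closure. -/
theorem exists_tendsto_of_mem_closure {E : Type*} [NormedAddCommGroup E] [CompleteSpace E]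
    {T : ℕ → E → E} (hT : ∀ n x y, ‖T n x - T n y‖ ≤ ‖x - y‖) {S : Set E}
    (hS : ∀ x ∈ S, ∃ (m : ℕ) (L : E), ∀ n, m ≤ n → T n x = L) {x : E} (hx : x ∈ closure S) :
    ∃ L, Tendsto (fun n => T n x) atTop (𝓝 L) := by
  refine cauchySeq_tendsto_of_complete (Metric.cauchySeq_iff'.2 fun ε hε => ?_)
  obtain ⟨y, hy, hxy⟩ := Metric.mem_closure_iff.1 hx (ε / 2) (half_pos hε)
  obtain ⟨m, L, hL⟩ := hS y hy
  refine ⟨m, fun n hn => ?_⟩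
  have h1 : ∀ n, m ≤ n → dist (T n x) L < ε / 2 := fun n hn => by
    rw [← hL n hn, dist_eq_norm]
    exact (hT n x y).trans_lt (by rwa [← dist_eq_norm])
  calc dist (T n x) (T m x) ≤ dist (T n x) L + dist (T m x) L := dist_triangle_right _ _ _
    _ < ε := by linarith [h1 n hn, h1 m le_rfl]

/-- If `Kᗮ` is finite dimensional, the averages are constant from `N = D` on; otherwise they converge
because they are contractions and are eventually constant on a dense subalgebra. -/
theorem exists_tendsto_condExpApprox {K : Submodule ℂ (OneParticle d)}
    (hK : IsClosed (K : Set (OneParticle d))) {D : ℕ∞}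
    (f : HilbertBasis {n : ℕ // (n : ℕ∞) < D} ℂ Kᗮ) {A : Fock d →L[ℂ] Fock d}
    (hA : A ∈ carAlgebra (⊤ : Submodule ℂ (OneParticle d))) :
    ∃ L, Tendsto (fun N => condExpApprox f N A) atTop (𝓝 L) := by
  -- for any extension of the basis to a sequence, the average only depends on the number of modes
  have hcast : ∀ (F : ℕ → OneParticle d), (∀ n, F n.1 = f n) → ∀ N M : ℕ,
      (min (N : ℕ∞) D).toNat = M → condExpApprox f N A = krausAverage (fun i : Fin M => F i) A := by
    rintro F hF N M rfl
    unfold condExpApprox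
    congr 1
    exact funext fun i => (hF ⟨i, lt_of_lt_toNat_min i.2⟩).symm
  induction D using ENat.recTopCoe with
  | coe k =>
    let F : ℕ → OneParticle d := fun n => if h : (n : ℕ∞) < k then f ⟨n, h⟩ else 0
    refine ⟨krausAverage (fun i : Fin k => F i) A, tendsto_const_nhds.congr' ?_⟩
    filter_upwards [eventually_ge_atTop k] with N hN
    refine (hcast F (fun n => dif_pos n.2) N k ?_).symm
    rw [min_eq_right (Nat.cast_le.2 hN), ENat.toNat_natCast]
  | top =>
    let F : ℕ → OneParticle d := fun n => f ⟨n, ENat.natCast_lt_top n⟩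
    have hFo : Orthonormal ℂ F :=
      (f.orthonormal.comp_linearIsometry Kᗮ.subtypeₗᵢ).comp
        (fun n => ⟨n, ENat.natCast_lt_top n⟩) fun a b hab => by simpa using hab
    have hspan : Kᗮ ≤ (Submodule.span ℂ (Set.range F)).topologicalClosure := by
      intro x hx
      have h1 : (⟨x, hx⟩ : Kᗮ) ∈ (Submodule.span ℂ (Set.range f)).topologicalClosure := by
        rw [f.dense_span]
        exact Submodule.mem_top
      have h2 : (Submodule.span ℂ (Set.range f)).topologicalClosure ≤
          ((Submodule.span ℂ (Set.range F)).topologicalClosure).comap Kᗮ.subtype := by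
        refine Submodule.topologicalClosure_minimal _ (Submodule.span_le.2 ?_)
          ((Submodule.isClosed_topologicalClosure _).preimage continuous_subtype_val)
        rintro _ ⟨n, rfl⟩
        exact Submodule.le_topologicalClosure _ (Submodule.subset_span ⟨n.1, rfl⟩)
      exact h2 h1
    have hcA := carAlgebra_top_le_topologicalClosure hK hFo (fun n => (f _).2) hspan hA
    obtain ⟨L, hL⟩ := exists_tendsto_of_mem_closure
      (T := fun N => krausAverage (fun i : Fin N => F i))
      (fun N X Y => by
        rw [← krausAverage_sub]
        exact norm_krausAverage_le _ (fun i => hFo.1 i) _)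
      (fun X hX => exists_krausAverage_eq_of_mem_eventuallyGraded hFo hX) hcA
    refine ⟨L, hL.congr fun N => (hcast F (fun n => rfl) N N ?_).symm⟩
    rw [min_eq_left le_top, ENat.toNat_natCast]

/-! ### The even algebra over the subspace -/

/-- Even elements over `K` commute with the modes orthogonal to `K`: passing a monomial of length `k`
through a mode gives the sign `(-1) ^ k`. -/
theorem signCommutes_one_of_mem_evenAlgebra {K : Submodule ℂ (OneParticle d)}
    {B : Fock d →L[ℂ] Fock d} (hB : B ∈ evenAlgebra K) {h : OneParticle d} (hh : h ∈ Kᗮ) :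
    SignCommutes 1 h B := by
  have hmon : ∀ l : List (Fock d →L[ℂ] Fock d),
      (∀ T ∈ l, ∃ g ∈ K, T = annihilation g ∨ T = creation g) →
      SignCommutes ((-1) ^ l.length) h l.prod := by
    intro l
    induction l with
    | nil => exact fun _ => SignCommutes.one
    | cons T l ih =>
      intro hl
      rw [List.prod_cons, List.length_cons, pow_succ']
      refine SignCommutes.mul ?_ (ih fun S hS => hl S (List.mem_cons_of_mem T hS))
      obtain ⟨g, hg, rfl | rfl⟩ := hl T List.mem_cons_self
      · exact signCommutes_annihilation (hh g hg)
      · exact signCommutes_creation (hh g hg)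
  have hle : evenAlgebra K ≤ StarSubalgebra.centralizer ℂ {annihilation h} := by
    refine StarSubalgebra.topologicalClosure_minimal (StarAlgebra.adjoin_le ?_)
      (Set.isClosed_centralizer _)
    rintro _ ⟨l, hl, hlK, rfl⟩
    have h1 := hmon l hlK
    rw [hl.neg_one_pow] at h1
    refine (StarSubalgebra.mem_centralizer_iff ℂ).2 fun x hx => ?_
    obtain rfl := hx
    rw [star_annihilation]
    exact ⟨by simpa using h1.1.symm, by simpa using h1.2.symm⟩
  have h2 := ((StarSubalgebra.mem_centralizer_iff ℂ).1 (hle hB)) (annihilation h) rfl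
  rw [star_annihilation] at h2
  exact ⟨by simpa using h2.1.symm, by simpa using h2.2.symm⟩

theorem evenAlgebra_le_carAlgebra (K : Submodule ℂ (OneParticle d)) :
    evenAlgebra K ≤ carAlgebra K := by
  refine StarSubalgebra.topologicalClosure_mono (StarAlgebra.adjoin_le ?_)
  rintro _ ⟨l, -, hl, rfl⟩
  refine list_prod_mem fun T hT => ?_
  obtain ⟨g, hg, rfl | rfl⟩ := hl T hT
  · exact StarAlgebra.subset_adjoin ℂ _ ⟨g, hg, rfl⟩
  · exact star_mem (StarAlgebra.subset_adjoin ℂ _ ⟨g, hg, rfl⟩)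

end Convergence

end Fermion

end

theorem corollary5p4 (d : ℕ) (K : Submodule ℂ (Fermion.OneParticle d))
    (hK : IsClosed (K : Set (Fermion.OneParticle d))) (D : ℕ∞)
    (f : HilbertBasis {n : ℕ // (n : ℕ∞) < D} ℂ Kᗮ) :
    (∀ A ∈ Fermion.carAlgebra (⊤ : Submodule ℂ (Fermion.OneParticle d)),
      Filter.Tendsto (fun N => Fermion.condExpApprox f N A) Filter.atTop
        (nhds (Fermion.condExp f A))) ∧
    ∀ A ∈ Fermion.evenAlgebra (⊤ : Submodule ℂ (Fermion.OneParticle d)),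
      ∀ B ∈ Fermion.evenAlgebra K, ∀ C ∈ Fermion.evenAlgebra K,
        Fermion.condExp f (B * A * C) = B * Fermion.condExp f A * C := by
  have hlim : ∀ A ∈ Fermion.carAlgebra (⊤ : Submodule ℂ (Fermion.OneParticle d)),
      Filter.Tendsto (fun N => Fermion.condExpApprox f N A) Filter.atTop
        (nhds (Fermion.condExp f A)) := fun A hA =>
    tendsto_nhds_limUnder (Fermion.exists_tendsto_condExpApprox hK f hA)
  refine ⟨hlim, fun A hA B hB C hC => ?_⟩
  have h := ((hlim A (Fermion.evenAlgebra_le_carAlgebra ⊤ hA)).const_mul B).mul_const C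
  refine (h.congr fun N => ?_).limUnder_eq
  exact (Fermion.krausAverage_mul_mul _
    (fun i => Fermion.signCommutes_one_of_mem_evenAlgebra hB (Subtype.property _))
    (fun i => Fermion.signCommutes_one_of_mem_evenAlgebra hC (Subtype.property _)) A).symm
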